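/- Let $p$ be a prime, let $\overline{\mathbf{Q}}_p$ be an algebraic closure of $\mathbf{Q}_p$ and $\mathbf{C}_p$ its $p$-adic completion. Let $K \subseteq \overline{\mathbf{Q}}_p$ be a finite extension of $\mathbf{Q}_p$, let $\chi_K : \mathrm{Gal}(\overline{\mathbf{Q}}_p/K) \to \mathbf{Z}_p^\times$ be the cyclotomic character, and let $H_K$ be the kernel of $\chi_K^{p-1}$ (of $\chi_K^2$ if $p = 2$), equipped with the topology induced by the Krull topology; it acts on $\mathbf{C}_p$ by extending its action on $\overline{\mathbf{Q}}_p$ continuously. **Theorem.** Let $\mathfrak{M}$ be a (non-archimedean) Banach space over $\mathbf{C}_p$ equipped with an additive action of $H_K$ such that the map $H_K \times \mathfrak{M} \to \mathfrak{M}$ is continuous and the action is semilinear, i.e. $h(cm) = h(c)\,h(m)$ for all $h \in H_K$, $c \in \mathbf{C}_p$, $m \in \mathfrak{M}$. Then the continuous cohomology groups satisfy $H^n(H_K, \mathfrak{M}) = 0$ for every integer $n > 0$. -/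

import Mathlib

noncomputable section

namespace PadicGalois

variable (p : ℕ) [Fact p.Prime]

/-- The `p`-adic cyclotomic character `χ_K : Gal(ℚ̄_p/K) → ℤ_pˣ` of a field `ℚ_p ⊆ K ⊆ ℚ̄_p`. -/
def cyclotomicChar (K : IntermediateField ℚ_[p] (PadicAlgCl p)) :
    Gal((PadicAlgCl p)/K) →* ℤ_[p]ˣ :=
  (cyclotomicCharacter (PadicAlgCl p) p).comp
    (MulSemiringAction.toRingAut Gal((PadicAlgCl p)/K) (PadicAlgCl p))

/-- The subgroup `H_K` of `Gal(ℚ̄_p/K)`: the kernel of `χ_K ^ (p - 1)`, or of `χ_K ^ 2` if `p = 2`.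
It carries the subspace topology of the Krull topology. -/
def HK (K : IntermediateField ℚ_[p] (PadicAlgCl p)) : Subgroup Gal((PadicAlgCl p)/K) :=
  (cyclotomicChar p K ^ (if p = 2 then 2 else p - 1)).ker

variable {p}

/-- Galois automorphisms are isometries of `ℚ̄_p`. -/
theorem isometry_gal {K : IntermediateField ℚ_[p] (PadicAlgCl p)} (σ : Gal((PadicAlgCl p)/K)) :
    Isometry ((σ : PadicAlgCl p →+* PadicAlgCl p)) := by
  refine AddMonoidHomClass.isometry_of_norm _ fun x => ?_
  exact (spectralNorm_eq_of_equiv (AlgEquiv.restrictScalars ℚ_[p] σ) x).symm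

/-- The action of `σ ∈ Gal(ℚ̄_p/K)` on `ℂ_p`: the unique continuous extension of `σ`. -/
def actCp {K : IntermediateField ℚ_[p] (PadicAlgCl p)} (σ : Gal((PadicAlgCl p)/K)) :
    ℂ_[p] →+* ℂ_[p] :=
  UniformSpace.Completion.mapRingHom (σ : PadicAlgCl p →+* PadicAlgCl p) (isometry_gal σ).continuous

end PadicGalois

/-- A topological abelian group `M` with a continuous additive action of a topological group `G`,
as an object of the category of topological representations of `G` over the discrete ring `ℤ`
(so that its continuous cohomology is the usual one of a topological `G`-module). -/
def topRepOfAction (G M : Type*) [Group G] [TopologicalSpace G] [AddCommGroup M]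
    [TopologicalSpace M] [IsTopologicalAddGroup M] [DistribMulAction G M] [ContinuousSMul G M] :
    TopRep ℤ G :=
  TopRep.of (X := M)
    { toMonoidHom :=
        { toFun := fun g =>
            { toFun := fun m => g • m
              map_add' := smul_add g
              map_smul' := fun n m => smul_comm g n m
              cont := continuous_const_smul g }
          map_one' := by ext m; exact one_smul G m
          map_mul' := fun g h => by ext m; exact mul_smul g h m } }

end

/-! Write F for the field `cycField` generated over Q_p by all p-power roots of unity. The theorem
follows from Tate's almost étale descent: traces along F are almost surjective, `HK` differs from
the Galois group of F only by a finite index of bounded norm, and averaging against elements of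
trace one makes cocycles into coboundaries up to a smaller error.

Almost purity. Integral elements of F are p-th powers modulo p (`frobSurj_cycField`), since the
integers of Q_p(ζ) are polynomials in 1 - ζ and ζ has a p-th root in F. Modulo p, Frobenius commutes
with sums, hence with traces and discriminants. If Frobenius is surjective modulo p on a finite
extension E and |Tr x| > |p| for some integral x, then lifting through Frobenius repeatedly extracts
p-th roots of |Tr x|, giving trace-one elements of norm near 1 (`FrobSurj.almostTrace`).
Surjectivity passes from the base to an extension generated by an element whose discriminant is
close to a unit (`FrobSurj.of_discr`). Such generators are plentiful: perturbing the constant term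
of a polynomial of degree prime to p separates its roots while moving them only slightly
(`exists_almostTrace_near`). The perturbation bound depends only on the degree, so the approximation
can be iterated with rescaling, and Krasner's argument puts any given element inside a tower of such
extensions (`FrobSurj.exists_almostTrace`).

Transfer. The elements of `HK` with trivial cyclotomic character form a subgroup of index m at most
p - 1 (or 2), so |m| ≥ 1/2. Dividing by m moves trace-one elements from the Galois group of F to the
open subgroups of `HK`, with norm at most 4 (`exists_isTransversal_sum_eq_one`).

Descent. A homogeneous cocycle is nearly constant on cosets of a small open subgroup in its first
variable. Averaging that variable against a trace-one element writes it as a coboundary plus a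
cocycle of half the size (`IsDescentCocycle.exists_approx`). The corrections form a geometric
series, which converges by completeness (`IsDescentCocycle.exists_eq`). -/

noncomputable section

set_option linter.unusedSectionVars false

/-! ### Congruences modulo p in the unit ball of an ultrametric field -/

section UnitBall

variable (L : Type*) [NormedField L] [IsUltrametricDist L]

/-- The closed unit ball of an ultrametric normed field, as a subring. -/
def unitBall : Subring L where
  carrier := {x | ‖x‖ ≤ 1}
  mul_mem' {a b} ha hb := by
    simpa using mul_le_one₀ ha (norm_nonneg b) hb
  one_mem' := by simp
  add_mem' {a b} ha hb := (IsUltrametricDist.norm_add_le_max a b).trans (max_le ha hb)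
  zero_mem' := by simp
  neg_mem' {a} ha := by simpa using ha

variable {L}

@[simp] theorem mem_unitBall {x : L} : x ∈ unitBall L ↔ ‖x‖ ≤ 1 := Iff.rfl

/-- The unit ball modulo the natural number `p`. -/
abbrev BallMod (L : Type*) [NormedField L] [IsUltrametricDist L] (p : ℕ) : Type _ :=
  unitBall L ⧸ Ideal.span {((p : ℕ) : unitBall L)}

variable {p : ℕ}

/-- The quotient (x - y)/p lies in the unit ball precisely under the norm bound. This translates
estimates into identities in a ring of characteristic p, where Frobenius is a homomorphism. -/
theorem ballMod_mk_eq_iff (hp : (p : L) ≠ 0) (x y : unitBall L) :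
    (Ideal.Quotient.mk (Ideal.span {((p : ℕ) : unitBall L)}) x = Ideal.Quotient.mk _ y) ↔
      ‖(x : L) - y‖ ≤ ‖(p : L)‖ := by
  rw [Ideal.Quotient.eq, Ideal.mem_span_singleton]
  constructor
  · rintro ⟨c, hc⟩
    have := congrArg (fun t : unitBall L => (t : L)) hc
    simp only [AddSubgroupClass.coe_sub, Subring.coe_mul] at this
    rw [this, norm_mul]
    have hc1 : ‖(c : L)‖ ≤ 1 := c.2
    simpa using mul_le_of_le_one_right (norm_nonneg (p : L)) hc1
  · intro h
    refine ⟨⟨((x : L) - y) / p, ?_⟩, ?_⟩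
    · rw [mem_unitBall, norm_div]
      exact div_le_one_of_le₀ h (norm_nonneg _)
    · ext
      simp [mul_div_cancel₀ _ hp]

theorem norm_pow_sub_pow_le_of_le (hp : (p : L) ≠ 0) {x y : L}
    (hx : ‖x‖ ≤ 1) (hy : ‖y‖ ≤ 1) (h : ‖x - y‖ ≤ ‖(p : L)‖) (n : ℕ) :
    ‖x ^ n - y ^ n‖ ≤ ‖(p : L)‖ := by
  have := (ballMod_mk_eq_iff hp ⟨x, hx⟩ ⟨y, hy⟩).2 h
  have h2 := congrArg (· ^ n) this
  simp only [← map_pow] at h2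
  simpa using (ballMod_mk_eq_iff hp _ _).1 h2

variable [Fact p.Prime]

theorem charP_ballMod (hp1 : ‖(p : L)‖ < 1) : CharP (BallMod L p) p := by
  refine CharP.quotient _ p fun hu => ?_
  obtain ⟨v, hv⟩ := hu.exists_right_inv
  have := congrArg (fun t : unitBall L => ‖(t : L)‖) hv
  simp only [Subring.coe_mul, norm_mul, Subring.coe_one, norm_one] at this
  have hv1 : ‖(v : L)‖ ≤ 1 := v.2
  have h3 : ‖(p : L)‖ * ‖(v : L)‖ ≤ ‖(p : L)‖ := mul_le_of_le_one_right (norm_nonneg _) hv1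
  simp at this
  linarith

theorem norm_sum_pow_sub_le (hp : (p : L) ≠ 0) (hp1 : ‖(p : L)‖ < 1) {ι : Type*}
    (s : Finset ι) (x : ι → L) (hx : ∀ i, ‖x i‖ ≤ 1) :
    ‖(∑ i ∈ s, x i) ^ p - ∑ i ∈ s, x i ^ p‖ ≤ ‖(p : L)‖ := by
  have := charP_ballMod (p := p) hp1
  let y : ι → unitBall L := fun i => ⟨x i, hx i⟩
  have h := (ballMod_mk_eq_iff hp ((∑ i ∈ s, y i) ^ p) (∑ i ∈ s, y i ^ p)).1 (by
    rw [map_pow, map_sum, map_sum, sum_pow_char]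
    simp)
  simpa [y] using h

theorem norm_add_pow_sub_le (hp : (p : L) ≠ 0) (hp1 : ‖(p : L)‖ < 1) {x y : L}
    (hx : ‖x‖ ≤ 1) (hy : ‖y‖ ≤ 1) : ‖(x + y) ^ p - (x ^ p + y ^ p)‖ ≤ ‖(p : L)‖ := by
  have := norm_sum_pow_sub_le hp hp1 Finset.univ ![x, y] (by
    intro i; fin_cases i <;> simpa)
  simpa [Fin.sum_univ_two] using this

/-- Frobenius is a ring endomorphism of the ball modulo p, so it commutes with determinants. -/
theorem norm_det_pow_sub_le (hp : (p : L) ≠ 0) (hp1 : ‖(p : L)‖ < 1) {ι : Type*} [Fintype ι]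
    [DecidableEq ι] (A B : Matrix ι ι L) (hA : ∀ i j, ‖A i j‖ ≤ 1) (hB : ∀ i j, ‖B i j‖ ≤ 1)
    (h : ∀ i j, ‖A i j ^ p - B i j‖ ≤ ‖(p : L)‖) :
    ‖A.det ^ p - B.det‖ ≤ ‖(p : L)‖ := by
  have := charP_ballMod (p := p) hp1
  let A' : Matrix ι ι (unitBall L) := Matrix.of fun i j => ⟨A i j, hA i j⟩
  let B' : Matrix ι ι (unitBall L) := Matrix.of fun i j => ⟨B i j, hB i j⟩
  have key : (frobenius (BallMod L p) p).mapMatrix ((Ideal.Quotient.mk _).mapMatrix A') =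
      (Ideal.Quotient.mk _).mapMatrix B' := by
    ext i j
    simp only [RingHom.mapMatrix_apply, Matrix.map_apply, frobenius_def, ← map_pow]
    rw [ballMod_mk_eq_iff hp]
    exact h i j
  have h2 := congrArg Matrix.det key
  rw [← RingHom.map_det, ← RingHom.map_det, ← RingHom.map_det, frobenius_def, ← map_pow,
    ballMod_mk_eq_iff hp] at h2
  have hdA : ((A'.det : unitBall L) : L) = A.det := by
    rw [← Subring.subtype_apply, RingHom.map_det]; rfl
  have hdB : ((B'.det : unitBall L) : L) = B.det := by
    rw [← Subring.subtype_apply, RingHom.map_det]; rfl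
  simpa [hdA, hdB] using h2

theorem norm_det_le_one {ι : Type*} [Fintype ι] [DecidableEq ι] (A : Matrix ι ι L)
    (hA : ∀ i j, ‖A i j‖ ≤ 1) : ‖A.det‖ ≤ 1 := by
  let A' : Matrix ι ι (unitBall L) := Matrix.of fun i j => ⟨A i j, hA i j⟩
  have hdA : ((A'.det : unitBall L) : L) = A.det := by
    rw [← Subring.subtype_apply, RingHom.map_det]; rfl
  rw [← hdA]
  exact A'.det.2

/-- Some term of the Leibniz expansion dominates, and any single factor bounds that term because the
others have norm at most one. -/
theorem exists_norm_det_le {ι : Type*} [Fintype ι] [Nonempty ι] [DecidableEq ι] (A : Matrix ι ι L)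
    (hA : ∀ i j, ‖A i j‖ ≤ 1) : ∃ i j, ‖A.det‖ ≤ ‖A i j‖ := by
  rw [Matrix.det_apply]
  obtain ⟨σ, -, hσ⟩ := IsUltrametricDist.exists_norm_finsetSum_le_of_nonempty
    (Finset.univ_nonempty (α := Equiv.Perm ι)) fun σ => Equiv.Perm.sign σ • ∏ i, A (σ i) i
  obtain ⟨i₀⟩ := ‹Nonempty ι›
  refine ⟨σ i₀, i₀, hσ.trans ?_⟩
  rw [Units.smul_def, zsmul_eq_mul, norm_mul, norm_prod,
    ← Finset.mul_prod_erase _ _ (Finset.mem_univ i₀)]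
  have h1 : ‖((Equiv.Perm.sign σ : ℤ) : L)‖ ≤ 1 := IsUltrametricDist.norm_intCast_le_one L _
  have h2 : ∏ i ∈ Finset.univ.erase i₀, ‖A (σ i) i‖ ≤ 1 :=
    Finset.prod_le_one (fun _ _ => norm_nonneg _) fun _ _ => hA _ _
  calc _ ≤ 1 * (‖A (σ i₀) i₀‖ * 1) := by gcongr
    _ = _ := by ring

theorem norm_eq_of_norm_sub_lt {x y : L} {r : ℝ} (h : ‖x - y‖ ≤ r) (hx : r < ‖x‖) :
    ‖y‖ = ‖x‖ := by
  have h1 : ‖x - y‖ < ‖x‖ := h.trans_lt hx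
  have h2 := IsUltrametricDist.norm_add_eq_max_of_norm_ne_norm (x := x) (y := y - x)
    (by rw [norm_sub_rev]; exact h1.ne')
  rw [add_sub_cancel, norm_sub_rev, max_eq_left h1.le] at h2
  exact h2

theorem norm_sub_le_trans {x y z : L} {r : ℝ} (h : ‖x - y‖ ≤ r) (h' : ‖y - z‖ ≤ r) :
    ‖x - z‖ ≤ r := by
  rw [← sub_add_sub_cancel x y z]
  exact (IsUltrametricDist.norm_add_le_max _ _).trans (max_le h h')

theorem norm_sub_le_of_le_of_le {x y : L} {r : ℝ} (h : ‖x‖ ≤ r) (h' : ‖y‖ ≤ r) :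
    ‖x - y‖ ≤ r := by
  rw [sub_eq_add_neg]
  exact (IsUltrametricDist.norm_add_le_max _ _).trans (max_le h (by rwa [norm_neg]))

end UnitBall

/-! ### Polynomials with coefficients in the unit ball -/

section Polynomials

open Polynomial

variable {L : Type*} [NormedField L] [IsUltrametricDist L]

theorem norm_eval_le_one {f : L[X]} (hf : ∀ i, ‖f.coeff i‖ ≤ 1) {x : L} (hx : ‖x‖ ≤ 1) :
    ‖f.eval x‖ ≤ 1 := by
  rw [eval_eq_sum_range]
  refine IsUltrametricDist.norm_sum_le_of_forall_le_of_nonneg zero_le_one fun i _ => ?_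
  rw [norm_mul, norm_pow]
  exact mul_le_one₀ (hf i) (by positivity) (pow_le_one₀ (norm_nonneg _) hx)

theorem norm_eval_sub_eval_le {f : L[X]} (hf : ∀ i, ‖f.coeff i‖ ≤ 1) {x y : L} (hx : ‖x‖ ≤ 1)
    (hy : ‖y‖ ≤ 1) : ‖f.eval x - f.eval y‖ ≤ ‖x - y‖ := by
  rw [eval_eq_sum_range, eval_eq_sum_range, ← Finset.sum_sub_distrib]
  refine IsUltrametricDist.norm_sum_le_of_forall_le_of_nonneg (norm_nonneg _) fun i _ => ?_
  rw [← mul_sub, norm_mul, sub_eq_add_neg, ← sub_eq_add_neg, ← (Commute.all x y).mul_geom_sum₂ i,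
    norm_mul]
  have h1 : ‖∑ j ∈ Finset.range i, x ^ j * y ^ (i - 1 - j)‖ ≤ 1 := by
    refine IsUltrametricDist.norm_sum_le_of_forall_le_of_nonneg zero_le_one fun j _ => ?_
    rw [norm_mul, norm_pow, norm_pow]
    exact mul_le_one₀ (pow_le_one₀ (norm_nonneg _) hx) (by positivity)
      (pow_le_one₀ (norm_nonneg _) hy)
  calc _ ≤ 1 * (‖x - y‖ * 1) := by gcongr; exact hf i
    _ = _ := by ring

/-- A root of a polynomial with coefficients in the unit ball and leading coefficient of norm one
lies in the unit ball. -/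
theorem norm_root_le_one {f : L[X]} (hf : ∀ i, ‖f.coeff i‖ ≤ 1) (hl : ‖f.leadingCoeff‖ = 1) {x : L}
    (hx : f.eval x = 0) : ‖x‖ ≤ 1 := by
  by_contra! h
  rw [eval_eq_sum_range, Finset.sum_range_succ, add_eq_zero_iff_eq_neg] at hx
  have hx0 : 0 < ‖x‖ := by linarith
  have h1 : ‖x‖ ^ f.natDegree = ‖∑ i ∈ Finset.range f.natDegree, f.coeff i * x ^ i‖ := by
    rw [hx, norm_neg, norm_mul, norm_pow, coeff_natDegree, hl, one_mul]
  rcases Nat.eq_zero_or_pos f.natDegree with h0 | h0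
  · rw [h0] at h1; simp at h1
  have h2 : ‖∑ i ∈ Finset.range f.natDegree, f.coeff i * x ^ i‖ ≤ ‖x‖ ^ (f.natDegree - 1) := by
    refine IsUltrametricDist.norm_sum_le_of_forall_le_of_nonneg (by positivity) fun i hi => ?_
    rw [norm_mul, norm_pow]
    calc _ ≤ 1 * ‖x‖ ^ i := by gcongr; exact hf i
      _ = ‖x‖ ^ i := one_mul _
      _ ≤ _ := pow_le_pow_right₀ h.le (by have := Finset.mem_range.1 hi; omega)
  have h3 : ‖x‖ ^ (f.natDegree - 1) < ‖x‖ ^ f.natDegree := pow_lt_pow_right₀ h (by omega)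
  linarith

/-- Coefficients of a monic split polynomial with roots in the unit ball lie in the unit ball. -/
theorem norm_coeff_le_one_of_roots {f : L[X]} (hm : f.Monic) (hs : f.Splits)
    (hr : ∀ x ∈ f.roots, ‖x‖ ≤ 1) (i : ℕ) : ‖f.coeff i‖ ≤ 1 := by
  have hf : f = (f.roots.attach.map fun x : {x // x ∈ f.roots} =>
      (X - C (⟨x.1, hr _ x.2⟩ : unitBall L))).prod.map (unitBall L).subtype := by
    rw [Polynomial.map_multiset_prod, Multiset.map_map]
    conv_lhs => rw [hs.eq_prod_roots_of_monic hm]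
    congr 1
    conv_lhs => rw [← Multiset.attach_map_val f.roots, Multiset.map_map]
    refine Multiset.map_congr rfl fun x _ => ?_
    simp
  rw [hf, coeff_map]
  exact mem_unitBall.1 (SetLike.coe_mem _)

end Polynomials

/-! ### Frobenius modulo p and the size of traces -/

namespace PadicGalois

instance isScalarTower_intermediateField {K F L : Type*} [Field K] [Field F] [Field L] [Algebra K F]
    [Algebra F L] [Algebra K L] [IsScalarTower K F L] (E : IntermediateField F L) :
    IsScalarTower K E L :=
  IsScalarTower.of_algebraMap_eq fun _ => rfl

variable {p : ℕ} [Fact p.Prime]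

theorem natCast_p_ne_zero : (p : PadicAlgCl p) ≠ 0 := by
  exact_mod_cast (Fact.out : p.Prime).ne_zero

theorem norm_natCast_p : ‖(p : PadicAlgCl p)‖ = (p : ℝ)⁻¹ := by
  rw [← map_natCast (algebraMap ℚ_[p] (PadicAlgCl p)), PadicAlgCl.norm_extends, Padic.norm_p]

theorem norm_natCast_p_pos : 0 < ‖(p : PadicAlgCl p)‖ := norm_pos_iff.2 natCast_p_ne_zero

theorem norm_natCast_p_lt_one : ‖(p : PadicAlgCl p)‖ < 1 := by
  rw [norm_natCast_p]
  exact inv_lt_one_of_one_lt₀ (by exact_mod_cast (Fact.out : p.Prime).one_lt)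

variable {F : Type*} [Field F] [Algebra ℚ_[p] F] [Algebra F (PadicAlgCl p)]
    [IsScalarTower ℚ_[p] F (PadicAlgCl p)]

/-- The norm is the spectral norm, hence a function of the minimal polynomial over Q_p alone. -/
theorem norm_algHom {E : Type*} [Field E] [Algebra ℚ_[p] E] [Algebra E (PadicAlgCl p)]
    [IsScalarTower ℚ_[p] E (PadicAlgCl p)] (σ : E →ₐ[ℚ_[p]] PadicAlgCl p) (x : E) :
    ‖σ x‖ = ‖algebraMap E (PadicAlgCl p) x‖ := by
  have h : ∀ y : PadicAlgCl p, ‖y‖ = spectralValue (minpoly ℚ_[p] y) := fun y => rfl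
  rw [h, h, minpoly.algHom_eq σ σ.injective,
    minpoly.algebraMap_eq (algebraMap E (PadicAlgCl p)).injective]

theorem norm_algHom_intermediateField {E : IntermediateField F (PadicAlgCl p)}
    (σ : E →ₐ[F] PadicAlgCl p) (x : E) :
    ‖σ x‖ = ‖(x : PadicAlgCl p)‖ :=
  norm_algHom (σ.restrictScalars ℚ_[p]) x

variable (p F) in
/-- Every integral element of `F` is a `p`-th power modulo `p`. -/
def FrobSurj : Prop :=
  ∀ a : F, ‖algebraMap F (PadicAlgCl p) a‖ ≤ 1 →
    ∃ b : F, ‖algebraMap F (PadicAlgCl p) a - algebraMap F (PadicAlgCl p) b ^ p‖ ≤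
      ‖(p : PadicAlgCl p)‖

/-- The field `E` has elements of trace one over `F`, of norm arbitrarily close to one. -/
def AlmostTrace (E : IntermediateField F (PadicAlgCl p)) : Prop :=
  ∀ ε : ℝ, 0 < ε → ∃ α : E, Algebra.trace F E α = 1 ∧ ‖(α : PadicAlgCl p)‖ ≤ 1 + ε

theorem norm_le_one_of_sub_pow {a b : PadicAlgCl p} {r : ℝ} (hr : r ≤ 1) (ha : ‖a‖ ≤ 1)
    (h : ‖a - b ^ p‖ ≤ r) : ‖b‖ ≤ 1 := by
  have h1 : ‖b ^ p‖ ≤ 1 := by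
    rw [show b ^ p = a - (a - b ^ p) by ring]
    exact norm_sub_le_of_le_of_le ha (h.trans hr)
  rw [norm_pow] at h1
  exact (pow_le_one_iff_of_nonneg (norm_nonneg _) (Fact.out : p.Prime).ne_zero).1 h1

/-- Surjectivity of the Frobenius modulo some element of norm `r < 1` implies surjectivity
modulo `p`. -/
theorem FrobSurj.of_weak {r : ℝ} (t : F) (ht0 : t ≠ 0) (ht : ‖algebraMap F (PadicAlgCl p) t‖ < 1)
    (hrt : r ≤ ‖algebraMap F (PadicAlgCl p) t‖ ^ p)
    (h : ∀ a : F, ‖algebraMap F (PadicAlgCl p) a‖ ≤ 1 →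
      ∃ b : F, ‖algebraMap F (PadicAlgCl p) a - algebraMap F (PadicAlgCl p) b ^ p‖ ≤ r) :
        FrobSurj p F := by
  set v := algebraMap F (PadicAlgCl p) with hv
  have hp0 : p ≠ 0 := (Fact.out : p.Prime).ne_zero
  have hvt : v t ≠ 0 := by simpa using ht0
  have key : ∀ k : ℕ, ∀ a : F, ‖v a‖ ≤ 1 →
      ∃ b : F, ‖v a - v b ^ p‖ ≤ max ‖(p : PadicAlgCl p)‖ (‖v t‖ ^ (p * k)) := by
    intro k
    induction k with
    | zero =>
      intro a ha
      refine ⟨0, ?_⟩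
      simp [hp0, ha]
    | succ k ih =>
      intro a ha
      obtain ⟨b, hb⟩ := ih a ha
      rcases le_total (‖v t‖ ^ (p * k)) ‖(p : PadicAlgCl p)‖ with hle | hle
      · rw [max_eq_left hle] at hb
        exact ⟨b, hb.trans (le_max_left _ _)⟩
      rw [max_eq_right hle] at hb
      have hb1 : ‖v b‖ ≤ 1 := norm_le_one_of_sub_pow (pow_le_one₀ (norm_nonneg _) ht.le) ha hb
      -- The error divided by t^(pk) is again integral, so it is close to some b'^p. Since t^(pk) =
      -- (t^k)^p, the improved root is b + t^k b', up to the error p of additivity of Frobenius.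
      obtain ⟨b', hb'⟩ := h ((a - b ^ p) / t ^ (p * k)) (by
        rw [map_div₀, map_sub, map_pow, map_pow, norm_div, norm_pow (v t)]
        exact div_le_one_of_le₀ hb (by positivity))
      have hr1 : r ≤ 1 := hrt.trans (pow_le_one₀ (norm_nonneg _) ht.le)
      have hb'1 : ‖v b'‖ ≤ 1 := by
        refine norm_le_one_of_sub_pow hr1 ?_ hb'
        rw [map_div₀, map_sub, map_pow, map_pow, norm_div, norm_pow (v t)]
        exact div_le_one_of_le₀ hb (by positivity)
      refine ⟨b + t ^ k * b', ?_⟩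
      have e1 : ‖v a - (v b ^ p + (v (t ^ k * b')) ^ p)‖ ≤ ‖v t‖ ^ (p * (k + 1)) := by
        have : v a - (v b ^ p + (v (t ^ k * b')) ^ p) =
            v t ^ (p * k) * (v ((a - b ^ p) / t ^ (p * k)) - v b' ^ p) := by
          simp only [map_div₀, map_sub, map_pow, map_mul]
          field_simp
          ring
        rw [this, norm_mul, norm_pow, Nat.mul_succ, pow_add]
        gcongr
        exact hb'.trans hrt
      have e2 := norm_add_pow_sub_le natCast_p_ne_zero norm_natCast_p_lt_one hb1
        (y := v (t ^ k * b')) (by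
          rw [map_mul, map_pow, norm_mul, norm_pow]
          exact mul_le_one₀ (pow_le_one₀ (norm_nonneg _) ht.le) (norm_nonneg _) hb'1)
      rw [map_add]
      refine norm_sub_le_trans (e1.trans (le_max_right _ _)) ?_
      rw [norm_sub_rev]
      exact e2.trans (le_max_left _ _)
  intro a ha
  obtain ⟨k, hk⟩ := exists_pow_lt_of_lt_one (norm_natCast_p_pos (p := p))
    (pow_lt_one₀ (norm_nonneg _) ht hp0)
  obtain ⟨b, hb⟩ := key k a ha
  rw [pow_mul, max_eq_left hk.le] at hb
  exact ⟨b, hb⟩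

section Trace

variable {E : IntermediateField F (PadicAlgCl p)} [FiniteDimensional F E]

theorem charZero_tower (p : ℕ) [Fact p.Prime] (F : Type*) [Field F] [Algebra ℚ_[p] F] :
    CharZero F :=
  charZero_of_injective_algebraMap (algebraMap ℚ_[p] F).injective

theorem algebraMap_trace_eq_sum (x : E) :
    algebraMap F (PadicAlgCl p) (Algebra.trace F E x) = ∑ σ : E →ₐ[F] PadicAlgCl p, σ x := by
  have := charZero_tower p F
  exact trace_eq_sum_embeddings (PadicAlgCl p)

theorem norm_trace_le (x : E) :
    ‖algebraMap F (PadicAlgCl p) (Algebra.trace F E x)‖ ≤ ‖(x : PadicAlgCl p)‖ := by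
  rw [algebraMap_trace_eq_sum]
  exact IsUltrametricDist.norm_sum_le_of_forall_le_of_nonneg (norm_nonneg _) fun σ _ =>
    (norm_algHom_intermediateField σ x).le

theorem norm_trace_pow_sub_le {x : E} (hx : ‖(x : PadicAlgCl p)‖ ≤ 1) :
    ‖algebraMap F (PadicAlgCl p) (Algebra.trace F E x) ^ p -
      algebraMap F (PadicAlgCl p) (Algebra.trace F E (x ^ p))‖ ≤ ‖(p : PadicAlgCl p)‖ := by
  rw [algebraMap_trace_eq_sum, algebraMap_trace_eq_sum]
  simp_rw [map_pow]
  exact norm_sum_pow_sub_le natCast_p_ne_zero norm_natCast_p_lt_one _ _ fun σ =>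
    (norm_algHom_intermediateField σ x).le.trans hx

/-- If y^p ≡ x modulo p, then Tr(x) ≡ Tr(y^p) ≡ Tr(y)^p modulo p; the lower bound on |Tr x| turns
this congruence into an equality of norms. -/
theorem FrobSurj.exists_norm_trace_pow (hE : FrobSurj p E) {x : E} (hx : ‖(x : PadicAlgCl p)‖ ≤ 1)
    (htr : ‖(p : PadicAlgCl p)‖ < ‖algebraMap F (PadicAlgCl p) (Algebra.trace F E x)‖) :
    ∃ y : E, ‖(y : PadicAlgCl p)‖ ≤ 1 ∧ ‖algebraMap F (PadicAlgCl p) (Algebra.trace F E y)‖ ^ p =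
      ‖algebraMap F (PadicAlgCl p) (Algebra.trace F E x)‖ := by
  obtain ⟨y, hy⟩ := hE x hx
  have hy1 : ‖(y : PadicAlgCl p)‖ ≤ 1 := norm_le_one_of_sub_pow norm_natCast_p_lt_one.le hx hy
  refine ⟨y, hy1, ?_⟩
  rw [← norm_pow]
  have h1 : ‖algebraMap F (PadicAlgCl p) (Algebra.trace F E x) -
      algebraMap F (PadicAlgCl p) (Algebra.trace F E (y ^ p))‖ ≤ ‖(p : PadicAlgCl p)‖ := by
    rw [← map_sub, ← map_sub]
    refine (norm_trace_le _).trans ?_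
    simpa using hy
  have h2 := norm_trace_pow_sub_le (F := F) hy1
  refine norm_eq_of_norm_sub_lt (norm_sub_le_trans h1 ?_) htr
  rwa [norm_sub_rev]

/-- Repeated root extraction gives integral y with |Tr y| = |Tr x|^(1/p^n), which tends to 1; then y
/ Tr(y) has trace one and norm close to at most 1. -/
theorem FrobSurj.almostTrace (hE : FrobSurj p E) {x : E} (hx : ‖(x : PadicAlgCl p)‖ ≤ 1)
    (htr : ‖(p : PadicAlgCl p)‖ < ‖algebraMap F (PadicAlgCl p) (Algebra.trace F E x)‖) :
      AlmostTrace E := by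
  have hp0 : p ≠ 0 := (Fact.out : p.Prime).ne_zero
  set T : E → ℝ := fun y => ‖algebraMap F (PadicAlgCl p) (Algebra.trace F E y)‖ with hT
  have key : ∀ n : ℕ, ∃ y : E, ‖(y : PadicAlgCl p)‖ ≤ 1 ∧ T y ^ (p ^ n) = T x := by
    intro n
    induction n with
    | zero => exact ⟨x, hx, by simp⟩
    | succ n ih =>
      obtain ⟨y, hy, hyT⟩ := ih
      have hTy1 : T y ≤ 1 := (norm_trace_le y).trans hy
      obtain ⟨z, hz, hzT⟩ := hE.exists_norm_trace_pow (F := F) hy (htr.trans_le (by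
        change T x ≤ T y
        rw [← hyT]
        exact pow_le_of_le_one (norm_nonneg _) hTy1 (pow_ne_zero _ hp0)))
      exact ⟨z, hz, by rw [pow_succ', pow_mul]; simp only [hT] at hyT ⊢; rw [hzT, hyT]⟩
  intro ε hε
  have hTx : 0 < T x := norm_natCast_p_pos.trans htr
  obtain ⟨n, hn⟩ := pow_unbounded_of_one_lt (T x)⁻¹ (show 1 < 1 + ε by linarith)
  obtain ⟨y, hy, hyT⟩ := key n
  have hTy : 0 < T y := by
    refine (norm_nonneg _).lt_of_ne fun h => ?_
    have h' : T y = 0 := h.symm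
    rw [h', zero_pow (pow_ne_zero _ hp0)] at hyT
    exact hTx.ne hyT
  have hTy1 : T y ≤ 1 := (norm_trace_le y).trans hy
  have hne : Algebra.trace F E y ≠ 0 := fun h => by simp [hT, h] at hTy
  refine ⟨(Algebra.trace F E y)⁻¹ • y, by simp [hne], ?_⟩
  have h1 : (((Algebra.trace F E y)⁻¹ • y : E) : PadicAlgCl p) =
      (algebraMap F (PadicAlgCl p) (Algebra.trace F E y))⁻¹ * y := by
    rw [IntermediateField.coe_smul, Algebra.smul_def, map_inv₀]
  rw [h1, norm_mul, norm_inv]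
  have h2 : (T y)⁻¹ ≤ 1 + ε := by
    by_contra! hlt
    have h3 : (1 + ε) ^ (p ^ n) < (T x)⁻¹ := by
      rw [← hyT, ← inv_pow]
      exact pow_lt_pow_left₀ hlt (by positivity) (pow_ne_zero _ hp0)
    have h4 : (1 + ε) ^ n ≤ (1 + ε) ^ (p ^ n) :=
      pow_le_pow_right₀ (by linarith) (Nat.lt_pow_self (Fact.out : p.Prime).one_lt).le
    linarith
  calc (T y)⁻¹ * ‖(y : PadicAlgCl p)‖ ≤ (1 + ε) * 1 := by gcongr
    _ = 1 + ε := mul_one _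

end Trace

end PadicGalois

/-! ### Extensions generated by an element of large discriminant -/

namespace PadicGalois

variable {p : ℕ} [Fact p.Prime]
variable {F : Type*} [Field F] [Algebra ℚ_[p] F] [Algebra F (PadicAlgCl p)]
    [IsScalarTower ℚ_[p] F (PadicAlgCl p)]
variable {E : IntermediateField F (PadicAlgCl p)} [FiniteDimensional F E]

variable (p F) in
/-- `F` has elements of norm less than one, and arbitrarily close to one. -/
def NormsNearOne : Prop :=
  ∀ r : ℝ, r < 1 → ∃ t : F, r < ‖algebraMap F (PadicAlgCl p) t‖ ∧ ‖algebraMap F (PadicAlgCl p) t‖ <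
    1

theorem norm_traceMatrix_pow_le {z : E} (hz : ‖(z : PadicAlgCl p)‖ ≤ 1) {d : ℕ} (i j : Fin d) :
    ‖algebraMap F (PadicAlgCl p) (Algebra.traceMatrix F (fun i : Fin d => z ^ (i : ℕ)) i j)‖ ≤
      1 := by
  rw [Algebra.traceMatrix_apply, Algebra.traceForm_apply]
  refine (norm_trace_le _).trans ?_
  simpa [← pow_add] using pow_le_one₀ (norm_nonneg _) hz

/-- The discriminant is the determinant of the matrix with entries Tr(z^(i+j)), so one of these
traces is at least as large. -/
theorem exists_norm_discr_le_norm_trace {z : E} (hz : ‖(z : PadicAlgCl p)‖ ≤ 1) :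
    ∃ k : ℕ, ‖algebraMap F (PadicAlgCl p)
        (Algebra.discr F fun i : Fin (Module.finrank F E) => z ^ (i : ℕ))‖ ≤
      ‖algebraMap F (PadicAlgCl p) (Algebra.trace F E (z ^ k))‖ := by
  have : Nonempty (Fin (Module.finrank F E)) := ⟨⟨0, Module.finrank_pos⟩⟩
  obtain ⟨i, j, h⟩ := exists_norm_det_le ((algebraMap F (PadicAlgCl p)).mapMatrix
    (Algebra.traceMatrix F fun i : Fin (Module.finrank F E) => z ^ (i : ℕ)))
    (fun i j => norm_traceMatrix_pow_le hz i j)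
  refine ⟨i + j, ?_⟩
  rw [← RingHom.map_det] at h
  simpa [Algebra.discr_def, Algebra.traceMatrix_apply, Algebra.traceForm_apply, pow_add] using h

theorem norm_discr_pow_sub_le {z : E} (hz : ‖(z : PadicAlgCl p)‖ ≤ 1) {d : ℕ} :
    ‖algebraMap F (PadicAlgCl p) (Algebra.discr F fun i : Fin d => z ^ (i : ℕ)) ^ p -
      algebraMap F (PadicAlgCl p) (Algebra.discr F fun i : Fin d => (z ^ p) ^ (i : ℕ))‖ ≤
      ‖(p : PadicAlgCl p)‖ := by
  rw [Algebra.discr_def, Algebra.discr_def, RingHom.map_det, RingHom.map_det]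
  have hzp : ‖((z ^ p : E) : PadicAlgCl p)‖ ≤ 1 := by simpa using pow_le_one₀ (norm_nonneg _) hz
  refine norm_det_pow_sub_le natCast_p_ne_zero norm_natCast_p_lt_one _ _
    (fun i j => norm_traceMatrix_pow_le hz i j) (fun i j => norm_traceMatrix_pow_le hzp i j)
    fun i j => ?_
  simp only [RingHom.mapMatrix_apply, Matrix.map_apply, Algebra.traceMatrix_apply,
    Algebra.traceForm_apply]
  rw [show (z ^ p) ^ (i : ℕ) * (z ^ p) ^ (j : ℕ) = (z ^ (i : ℕ) * z ^ (j : ℕ)) ^ p by ring]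
  refine norm_trace_pow_sub_le ?_
  simpa [← pow_add] using pow_le_one₀ (norm_nonneg _) hz

/-- Powers of an integral element of nonzero discriminant generate all integral elements up to
multiplication by the discriminant. -/
theorem exists_discr_mul_eq_sum {w : E} (hw : ‖(w : PadicAlgCl p)‖ ≤ 1)
    (hd : (Algebra.discr F fun i : Fin (Module.finrank F E) => w ^ (i : ℕ)) ≠ 0)
    {a : E} (ha : ‖(a : PadicAlgCl p)‖ ≤ 1) :
    ∃ y : Fin (Module.finrank F E) → F, (∀ i, ‖algebraMap F (PadicAlgCl p) (y i)‖ ≤ 1) ∧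
      algebraMap F (PadicAlgCl p) (Algebra.discr F fun i : Fin (Module.finrank F E) => w ^ (i : ℕ))
        * a =
        ∑ i, algebraMap F (PadicAlgCl p) (y i) * (w : PadicAlgCl p) ^ (i : ℕ) := by
  have : Nonempty (Fin (Module.finrank F E)) := ⟨⟨0, Module.finrank_pos⟩⟩
  set b : Fin (Module.finrank F E) → E := fun i => w ^ (i : ℕ) with hb
  have hli : LinearIndependent F b := by
    by_contra h
    exact hd (Algebra.discr_zero_of_not_linearIndependent F h)
  let B := basisOfLinearIndependentOfCardEqFinrank hli (by simp)
  have hB : ∀ i, B i = b i := fun i => by simp [B]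
  have ha' : a = ∑ i, B.repr a i • b i := by
    conv_lhs => rw [← B.sum_repr a]
    simp [hB]
  set T := Algebra.traceMatrix F b with hT
  have hTx : T.mulVec (B.repr a) = fun j => Algebra.trace F E (b j * a) := by
    ext j
    conv_rhs => rw [ha']
    rw [Finset.mul_sum, map_sum]
    simp only [Matrix.mulVec, dotProduct, hT, Algebra.traceMatrix_apply, Algebra.traceForm_apply,
      mul_smul_comm, map_smul, smul_eq_mul]
    exact Finset.sum_congr rfl fun i _ => mul_comm _ _
  -- Cramer's rule for the trace matrix: the coordinates of a, multiplied by the discriminant, are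
  -- determinants of matrices of integral traces.
  have hcr : T.cramer (T.mulVec (B.repr a)) = T.det • (B.repr a : _ → F) := by
    rw [Matrix.cramer_eq_adjugate_mulVec, Matrix.mulVec_mulVec, Matrix.adjugate_mul,
      Matrix.smul_mulVec, Matrix.one_mulVec]
  refine ⟨fun i => T.det * B.repr a i, fun i => ?_, ?_⟩
  · have h1 := congrFun hcr i
    rw [Pi.smul_apply, smul_eq_mul, Matrix.cramer_apply] at h1
    beta_reduce
    rw [← h1, RingHom.map_det]
    refine norm_det_le_one _ fun k l => ?_
    rw [RingHom.mapMatrix_apply, Matrix.map_apply, Matrix.updateCol_apply]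
    split_ifs with h
    · rw [hTx]
      refine (norm_trace_le _).trans ?_
      simpa [hb] using mul_le_one₀ (pow_le_one₀ (norm_nonneg _) hw) (norm_nonneg _) ha
    · exact norm_traceMatrix_pow_le hw k l
  · conv_lhs => rw [ha']
    rw [Algebra.discr_def, ← hT]
    simp only [map_mul, mul_assoc, ← Finset.mul_sum]
    congr 1
    simp [hb, Algebra.smul_def]

/-- If `F` satisfies `FrobSurj`, so does a finite extension generated by an element whose
discriminant is close to a unit. -/
theorem FrobSurj.of_discr (hF : FrobSurj p F) (hn : NormsNearOne p F) {z : E}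
    (hz : ‖(z : PadicAlgCl p)‖ ≤ 1)
    (hd : ‖(p : PadicAlgCl p)‖ < ‖algebraMap F (PadicAlgCl p)
      (Algebra.discr F fun i : Fin (Module.finrank F E) => z ^ (i : ℕ))‖ ^ p) :
    FrobSurj p E := by
  have hp0 : p ≠ 0 := (Fact.out : p.Prime).ne_zero
  set v := algebraMap F (PadicAlgCl p) with hv
  set D := Algebra.discr F fun i : Fin (Module.finrank F E) => z ^ (i : ℕ)
  set D' := Algebra.discr F fun i : Fin (Module.finrank F E) => (z ^ p) ^ (i : ℕ) with hD'
  have hzp : ‖((z ^ p : E) : PadicAlgCl p)‖ ≤ 1 := by simpa using pow_le_one₀ (norm_nonneg _) hz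
  have hDD : ‖v D'‖ = ‖v D‖ ^ p := by
    rw [← norm_pow]
    exact norm_eq_of_norm_sub_lt (norm_discr_pow_sub_le hz) (by rwa [norm_pow])
  rw [← hDD] at hd
  have hD'pos : 0 < ‖v D'‖ := norm_natCast_p_pos.trans hd
  have hD'0 : D' ≠ 0 := fun h => by simp [h] at hD'pos
  have hD'1 : ‖v D'‖ ≤ 1 := by
    rw [hD', Algebra.discr_def, RingHom.map_det]
    exact norm_det_le_one _ fun i j => norm_traceMatrix_pow_le hzp i j
  obtain ⟨δ, hδ⟩ := hF D' hD'1
  have hδ1 : ‖v δ‖ ≤ 1 := norm_le_one_of_sub_pow norm_natCast_p_lt_one.le hD'1 hδ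
  have hδn : ‖v δ‖ ^ p = ‖v D'‖ := by
    rw [← norm_pow]
    exact norm_eq_of_norm_sub_lt hδ hd
  have hδ0 : v δ ≠ 0 := fun h => by simp [h, hp0] at hδn; simp [hδn] at hD'pos
  -- The construction yields p-th roots modulo p/D' only, where D' is the discriminant of z^p;
  -- `FrobSurj.of_weak` then upgrades this to modulo p. The element t below is close enough to norm
  -- one for that.
  set r := ‖(p : PadicAlgCl p)‖ / ‖v D'‖ with hr
  have hr1 : r < 1 := (div_lt_one hD'pos).2 hd
  have hr0 : 0 < r := div_pos norm_natCast_p_pos hD'pos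
  have hpR : (p : ℝ) ≠ 0 := by exact_mod_cast hp0
  obtain ⟨t, ht, ht1⟩ := hn (r ^ (1 / (p : ℝ))) (Real.rpow_lt_one hr0.le hr1 (by positivity))
  have hrt : r ≤ ‖v t‖ ^ p := by
    calc r = (r ^ (1 / (p : ℝ))) ^ p := by
          rw [← Real.rpow_natCast, ← Real.rpow_mul hr0.le, one_div, inv_mul_cancel₀ hpR,
            Real.rpow_one]
      _ ≤ ‖v t‖ ^ p := by gcongr
  have ht0 : t ≠ 0 := by
    rintro rfl
    rw [map_zero, norm_zero, zero_pow hp0] at hrt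
    linarith
  refine FrobSurj.of_weak (r := r) (algebraMap F E t) (by simpa using ht0) ?_ ?_ ?_
  · rwa [← IsScalarTower.algebraMap_apply]
  · rwa [← IsScalarTower.algebraMap_apply]
  intro a ha
  obtain ⟨y, hy, hsum⟩ := exists_discr_mul_eq_sum hzp hD'0 ha
  choose β hβ using fun i => hF (y i) (hy i)
  have hβ1 : ∀ i, ‖v (β i)‖ ≤ 1 := fun i =>
    norm_le_one_of_sub_pow norm_natCast_p_lt_one.le (hy i) (hβ i)
  -- Modulo p, D' a = ∑ y_i z^(pi) ≡ ∑ β_i^p z^(pi) ≡ b₀^p, and D' ≡ δ^p, so b₀/δ is the approximate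
  -- p-th root of a.
  set b₀ : E := ∑ i, algebraMap F E (β i) * z ^ (i : ℕ) with hb₀
  have hb₀v : (b₀ : PadicAlgCl p) = ∑ i, v (β i) * (z : PadicAlgCl p) ^ (i : ℕ) := by
    simp [hb₀, hv]
  have e1 : ‖(b₀ : PadicAlgCl p) ^ p -
      ∑ i, (v (β i) * (z : PadicAlgCl p) ^ (i : ℕ)) ^ p‖ ≤ ‖(p : PadicAlgCl p)‖ := by
    rw [hb₀v]
    exact norm_sum_pow_sub_le natCast_p_ne_zero norm_natCast_p_lt_one _ _ fun i => by
      rw [norm_mul, norm_pow]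
      exact mul_le_one₀ (hβ1 i) (by positivity) (pow_le_one₀ (norm_nonneg _) hz)
  have e2 : ‖v D' * a - ∑ i, (v (β i) * (z : PadicAlgCl p) ^ (i : ℕ)) ^ p‖ ≤
      ‖(p : PadicAlgCl p)‖ := by
    rw [hsum, ← Finset.sum_sub_distrib]
    refine IsUltrametricDist.norm_sum_le_of_forall_le_of_nonneg (norm_nonneg _) fun i _ => ?_
    have : v (y i) * ((z ^ p : E) : PadicAlgCl p) ^ (i : ℕ) -
        (v (β i) * (z : PadicAlgCl p) ^ (i : ℕ)) ^ p =
        (v (y i) - v (β i) ^ p) * ((z : PadicAlgCl p) ^ p) ^ (i : ℕ) := by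
      rw [SubmonoidClass.coe_pow]
      ring
    rw [this, norm_mul]
    have h3 : ‖((z : PadicAlgCl p) ^ p) ^ (i : ℕ)‖ ≤ 1 := by
      rw [norm_pow, norm_pow]
      exact pow_le_one₀ (by positivity) (pow_le_one₀ (norm_nonneg _) hz)
    calc _ ≤ ‖(p : PadicAlgCl p)‖ * 1 := by gcongr; exact hβ i
      _ = _ := mul_one _
  have e3 : ‖v δ ^ p * a - v D' * a‖ ≤ ‖(p : PadicAlgCl p)‖ := by
    rw [← sub_mul, norm_mul, norm_sub_rev]
    calc _ ≤ ‖(p : PadicAlgCl p)‖ * 1 := mul_le_mul hδ ha (norm_nonneg _) (norm_nonneg _)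
      _ = _ := mul_one _
  have e4 : ‖v δ ^ p * a - (b₀ : PadicAlgCl p) ^ p‖ ≤ ‖(p : PadicAlgCl p)‖ :=
    norm_sub_le_trans e3 (norm_sub_le_trans e2 (by rwa [norm_sub_rev]))
  refine ⟨b₀ / algebraMap F E δ, ?_⟩
  have : algebraMap E (PadicAlgCl p) a - algebraMap E (PadicAlgCl p) (b₀ / algebraMap F E δ) ^ p =
      (v δ ^ p * a - (b₀ : PadicAlgCl p) ^ p) / v δ ^ p := by
    rw [map_div₀, ← IsScalarTower.algebraMap_apply]
    change (a : PadicAlgCl p) - ((b₀ : PadicAlgCl p) / v δ) ^ p = _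
    rw [div_pow, eq_div_iff (pow_ne_zero _ hδ0), sub_mul, div_mul_cancel₀ _ (pow_ne_zero _ hδ0),
      mul_comm]
  rw [this, norm_div, norm_pow, hδn, hr]
  gcongr

theorem almostTrace_of_discr (hF : FrobSurj p F) (hn : NormsNearOne p F) {z : E}
    (hz : ‖(z : PadicAlgCl p)‖ ≤ 1)
    (hd : ‖(p : PadicAlgCl p)‖ < ‖algebraMap F (PadicAlgCl p)
      (Algebra.discr F fun i : Fin (Module.finrank F E) => z ^ (i : ℕ))‖ ^ p) :
    AlmostTrace E := by
  obtain ⟨k, hk⟩ := exists_norm_discr_le_norm_trace hz (F := F)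
  have hzk : ‖((z ^ k : E) : PadicAlgCl p)‖ ≤ 1 := by simpa using pow_le_one₀ (norm_nonneg _) hz
  refine (hF.of_discr hn hz hd).almostTrace (x := z ^ k) hzk (hd.trans_le ?_)
  have h1 := hk.trans ((norm_trace_le _).trans hzk)
  exact (pow_le_of_le_one (norm_nonneg _) h1 (Fact.out : p.Prime).ne_zero).trans hk

end PadicGalois

/-! ### Separating the roots of a polynomial by a small perturbation -/

section Polynomials

open Polynomial

variable {L : Type*} [NormedField L] [IsUltrametricDist L]

theorem Multiset.exists_pow_card_le_prod {s : Multiset NNReal} (hs : s ≠ 0) :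
    ∃ x ∈ s, x ^ s.card ≤ s.prod := by
  obtain ⟨x, hx, hmin⟩ : ∃ x ∈ s, ∀ y ∈ s, x ≤ y := by
    obtain ⟨a, ha⟩ := Multiset.exists_mem_of_ne_zero hs
    obtain ⟨x, hx, h⟩ := s.toFinset.exists_min_image id ⟨a, by simpa using ha⟩
    exact ⟨x, by simpa using hx, fun y hy => h y (by simpa using hy)⟩
  exact ⟨x, hx, Multiset.pow_card_le_prod hmin⟩

theorem nnnorm_multiset_prod (s : Multiset L) : ‖s.prod‖₊ = (s.map (‖·‖₊)).prod :=
  map_multiset_prod (nnnormHom : L →*₀ NNReal) s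

/-- The value g(y) is the product of the differences y - z over the roots z, so the nearest root
satisfies the bound. -/
theorem exists_root_norm_sub_pow_le [IsAlgClosed L] {g : L[X]} (hm : g.Monic)
    (hd : g.natDegree ≠ 0) (y : L) :
    ∃ z, g.eval z = 0 ∧ ‖y - z‖ ^ g.natDegree ≤ ‖g.eval y‖ := by
  have hs := IsAlgClosed.splits g
  have hcard := hs.natDegree_eq_card_roots
  obtain ⟨x, hx, hle⟩ := Multiset.exists_pow_card_le_prod (s := g.roots.map fun x => ‖y - x‖₊) (by
    intro h
    apply hd
    rw [hcard, ← Multiset.card_map (fun x => ‖y - x‖₊) g.roots, h, Multiset.card_zero])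
  obtain ⟨z, hz, rfl⟩ := Multiset.mem_map.1 hx
  refine ⟨z, (mem_roots'.1 hz).2, ?_⟩
  rw [Multiset.card_map, ← hcard] at hle
  have h2 : ‖g.eval y‖₊ = (g.roots.map fun x => ‖y - x‖₊).prod := by
    rw [hs.eval_eq_prod_roots_of_monic hm, nnnorm_multiset_prod, Multiset.map_map]
    rfl
  rw [← h2] at hle
  exact_mod_cast hle

/-- A perturbation by a constant `c` of a polynomial of degree prime to `p` has roots near the
roots of the given polynomial; they are separated if `c` is generic. -/
theorem exists_separated_root_near [IsAlgClosed L] [CharZero L] {f : L[X]} (hm : f.Monic)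
    (hN : ‖(f.natDegree : L)‖ = 1) (hf : ∀ i, ‖f.coeff i‖ ≤ 1) {y c : L} (hy : f.eval y = 0)
    (hc1 : ‖c‖ ≤ 1) (hc : ∀ ξ ∈ (derivative f).roots, ‖f.eval ξ‖ ≠ ‖c‖) :
    ∃ z, f.eval z = c ∧ ‖z‖ ≤ 1 ∧ ‖y - z‖ ^ f.natDegree ≤ ‖c‖ ∧
      ‖c‖ ^ (f.natDegree - 1) ≤ ‖(derivative f).eval z‖ := by
  have hN0 : f.natDegree ≠ 0 := fun h => by simp [h] at hN
  have hdeg : degree (C c) < degree f :=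
    degree_C_le.trans_lt (natDegree_pos_iff_degree_pos.1 (Nat.pos_of_ne_zero hN0))
  have hgm : (f - C c).Monic := hm.sub_of_left hdeg
  have hgN : (f - C c).natDegree = f.natDegree := natDegree_sub_C
  obtain ⟨z, hz, hyz⟩ := exists_root_norm_sub_pow_le hgm (by rwa [hgN]) y
  rw [hgN, eval_sub, hy, eval_C, zero_sub, norm_neg] at hyz
  rw [eval_sub, eval_C, sub_eq_zero] at hz
  have hgc : ∀ i, ‖(f - C c).coeff i‖ ≤ 1 := fun i => by
    rw [coeff_sub]
    refine norm_sub_le_of_le_of_le (hf i) ?_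
    rw [coeff_C]
    split_ifs <;> simp [hc1]
  have hz1 : ‖z‖ ≤ 1 := norm_root_le_one hgc (by simp [hgm.leadingCoeff])
    (by rw [eval_sub, eval_C, hz, sub_self])
  refine ⟨z, hz, hz1, hyz, ?_⟩
  have hs := IsAlgClosed.splits (derivative f)
  have hlead : (derivative f).leadingCoeff = f.natDegree := by
    rw [leadingCoeff_derivative, hm.leadingCoeff, one_mul]
  have hdc : ∀ i, ‖(derivative f).coeff i‖ ≤ 1 := fun i => by
    rw [coeff_derivative, norm_mul]
    refine mul_le_one₀ (hf _) (norm_nonneg _) ?_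
    exact_mod_cast IsUltrametricDist.norm_natCast_le_one L (i + 1)
  -- Since |c| ≠ |f(ξ)|, nothing cancels in f(z) - f(ξ) = c - f(ξ), which therefore has norm at
  -- least |c|; and f is 1-Lipschitz on the unit ball. The derivative, whose leading coefficient is
  -- a unit, is then bounded below by the product of its |z - ξ|.
  have hroot : ∀ ξ ∈ (derivative f).roots, ‖c‖ ≤ ‖z - ξ‖ := fun ξ hξ => by
    have hξ1 : ‖ξ‖ ≤ 1 := norm_root_le_one hdc (by rw [hlead, hN]) (mem_roots'.1 hξ).2
    refine le_trans ?_ (norm_eval_sub_eval_le hf hz1 hξ1)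
    rw [hz, sub_eq_add_neg, IsUltrametricDist.norm_add_eq_max_of_norm_ne_norm (by
      rw [norm_neg]; exact (hc ξ hξ).symm)]
    exact le_max_left _ _
  have h2 : ‖(derivative f).eval z‖₊ = ((derivative f).roots.map fun x => ‖z - x‖₊).prod := by
    rw [hs.eval_eq_prod_roots, hlead, nnnorm_mul, nnnorm_multiset_prod, Multiset.map_map]
    have : ‖(f.natDegree : L)‖₊ = 1 := by ext; simpa using hN
    rw [this, one_mul]
    rfl
  have h3 : ‖c‖₊ ^ (f.natDegree - 1) ≤ ‖(derivative f).eval z‖₊ := by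
    have h4 : (derivative f).roots.card ≤ f.natDegree - 1 :=
      (card_roots' _).trans (natDegree_derivative_le f)
    rw [h2]
    have h5 := Multiset.pow_card_le_prod
      (s := (derivative f).roots.map fun x => ‖z - x‖₊) (a := ‖c‖₊) (by
        intro x hx
        obtain ⟨ξ, hξ, rfl⟩ := Multiset.mem_map.1 hx
        exact_mod_cast hroot ξ hξ)
    rw [Multiset.card_map] at h5
    exact (pow_le_pow_of_le_one (zero_le) (by exact_mod_cast hc1) h4).trans h5
  exact_mod_cast h3

/-- With g = m h and m(z) = 0 one has g'(z) = m'(z) h(z), and h is integral because its roots are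
roots of g. -/
theorem norm_derivative_eval_le_of_dvd [IsAlgClosed L] {m g : L[X]} (hm : m.Monic) (hg : g.Monic)
    (hgc : ∀ i, ‖g.coeff i‖ ≤ 1) (hmg : m ∣ g) {z : L} (hz1 : ‖z‖ ≤ 1) (hz : m.eval z = 0) :
    ‖(derivative g).eval z‖ ≤ ‖(derivative m).eval z‖ := by
  obtain ⟨h, rfl⟩ := hmg
  have hh : h.Monic := hm.of_mul_monic_left hg
  have hhc := norm_coeff_le_one_of_roots hh (IsAlgClosed.splits h) fun x hx =>
    norm_root_le_one hgc (by simp [hg.leadingCoeff]) (by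
      rw [eval_mul, (mem_roots'.1 hx).2.eq_zero, mul_zero])
  rw [derivative_mul, eval_add, eval_mul, eval_mul, hz, zero_mul, add_zero, norm_mul]
  exact mul_le_of_le_one_right (norm_nonneg _) (norm_eval_le_one hhc hz1)

end Polynomials

/-! ### Approximation by elements of large discriminant -/

namespace PadicGalois

open Polynomial IntermediateField

variable {p : ℕ} [Fact p.Prime]
variable {F : Type*} [Field F] [Algebra ℚ_[p] F] [Algebra F (PadicAlgCl p)]
    [IsScalarTower ℚ_[p] F (PadicAlgCl p)]

theorem isAlgebraic_tower (F : Type*) [Field F] [Algebra ℚ_[p] F] [Algebra F (PadicAlgCl p)]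
    [IsScalarTower ℚ_[p] F (PadicAlgCl p)] : Algebra.IsAlgebraic F (PadicAlgCl p) :=
  Algebra.IsAlgebraic.tower_top (K := ℚ_[p]) F

theorem isIntegral_tower (F : Type*) [Field F] [Algebra ℚ_[p] F] [Algebra F (PadicAlgCl p)]
    [IsScalarTower ℚ_[p] F (PadicAlgCl p)] (x : PadicAlgCl p) : IsIntegral F x :=
  ((isAlgebraic_tower F).isAlgebraic x).isIntegral

theorem norm_root_minpoly {x y : PadicAlgCl p} (h : aeval x (minpoly F y) = 0) : ‖x‖ = ‖y‖ := by
  have h1 : aeval x (minpoly ℚ_[p] y) = 0 := by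
    obtain ⟨q, hq⟩ := minpoly.dvd_map_of_isScalarTower ℚ_[p] F y
    rw [← aeval_map_algebraMap F, hq, map_mul, h, zero_mul]
  have hy : IsIntegral ℚ_[p] y := Algebra.IsIntegral.isIntegral y
  have h2 := minpoly.eq_of_irreducible_of_monic (minpoly.irreducible hy) h1 (minpoly.monic hy)
  have h3 : ∀ y : PadicAlgCl p, ‖y‖ = spectralValue (minpoly ℚ_[p] y) := fun y => rfl
  rw [h3, h3, h2]

theorem norm_coeff_minpoly_le_one {y : PadicAlgCl p} (hy : ‖y‖ ≤ 1) (i : ℕ) :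
    ‖algebraMap F (PadicAlgCl p) ((minpoly F y).coeff i)‖ ≤ 1 := by
  rw [← coeff_map]
  refine norm_coeff_le_one_of_roots ((minpoly.monic (isIntegral_tower F y)).map _)
    (IsAlgClosed.splits _) (fun x hx => ?_) i
  have h := (mem_roots'.1 hx).2.eq_zero
  rw [eval_map_algebraMap] at h
  rwa [norm_root_minpoly h]

theorem norm_algebraNorm {E : IntermediateField F (PadicAlgCl p)} [FiniteDimensional F E] (x : E) :
    ‖algebraMap F (PadicAlgCl p) (Algebra.norm F x)‖ = ‖(x : PadicAlgCl p)‖ ^ Module.finrank F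
      E := by
  have := charZero_tower p F
  rw [Algebra.norm_eq_prod_embeddings, norm_prod]
  simp_rw [norm_algHom_intermediateField]
  rw [Finset.prod_const, Finset.card_univ, AlgHom.card]

/-- Up to sign the discriminant is the field norm of the different element m'(z), whose conjugates
all have the same absolute value. -/
theorem norm_discr_adjoin (z : PadicAlgCl p) :
    ‖algebraMap F (PadicAlgCl p) (Algebra.discr F fun i : Fin (Module.finrank F F⟮z⟯) =>
      AdjoinSimple.gen F z ^ (i : ℕ))‖ =
      ‖aeval z (derivative (minpoly F z))‖ ^ (minpoly F z).natDegree := by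
  have := charZero_tower p F
  have hz := isIntegral_tower F z
  have : FiniteDimensional F F⟮z⟯ := adjoin.finiteDimensional hz
  let pb := adjoin.powerBasis hz
  have h1 : ∀ d, d = pb.dim → (Algebra.discr F fun i : Fin d =>
      AdjoinSimple.gen F z ^ (i : ℕ)) = Algebra.discr F pb.basis := by
    rintro _ rfl
    rw [pb.coe_basis]
    rfl
  rw [h1 _ pb.finrank, Algebra.discr_powerBasis_eq_norm, map_mul, norm_mul, map_pow, norm_pow,
    map_neg, map_one, norm_neg, norm_one, one_pow, one_mul, norm_algebraNorm, adjoin.finrank hz]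
  congr 2
  rw [adjoin.powerBasis_gen, minpoly_gen]
  change algebraMap F⟮z⟯ (PadicAlgCl p) _ = _
  rw [← aeval_algebraMap_apply]
  rfl

theorem le_norm_discr_adjoin {g : F[X]} (hg : g.Monic)
    (hgc : ∀ i, ‖algebraMap F (PadicAlgCl p) (g.coeff i)‖ ≤ 1) {z : PadicAlgCl p} (hz1 : ‖z‖ ≤ 1)
    (hz : aeval z g = 0) :
    ‖aeval z (derivative g)‖ ^ g.natDegree ≤
      ‖algebraMap F (PadicAlgCl p) (Algebra.discr F fun i : Fin (Module.finrank F F⟮z⟯) =>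
        AdjoinSimple.gen F z ^ (i : ℕ))‖ := by
  have hzi := isIntegral_tower F z
  have hdvd := minpoly.dvd F z hz
  have hle : ‖aeval z (derivative g)‖ ≤ ‖aeval z (derivative (minpoly F z))‖ := by
    have := norm_derivative_eval_le_of_dvd (m := (minpoly F z).map (algebraMap F (PadicAlgCl p)))
      (g := g.map (algebraMap F (PadicAlgCl p))) ((minpoly.monic hzi).map _) (hg.map _)
      (by simpa using hgc) (Polynomial.map_dvd _ hdvd) hz1 (by simp [minpoly.aeval])
    simpa [derivative_map] using this
  have h1 : ‖aeval z (derivative g)‖ ≤ 1 := by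
    rw [← eval_map_algebraMap]
    refine norm_eval_le_one (fun i => ?_) hz1
    rw [← derivative_map, coeff_derivative, norm_mul, coeff_map]
    refine mul_le_one₀ (hgc _) (norm_nonneg _) ?_
    exact_mod_cast IsUltrametricDist.norm_natCast_le_one (PadicAlgCl p) (i + 1)
  rw [norm_discr_adjoin]
  calc _ ≤ ‖aeval z (derivative g)‖ ^ (minpoly F z).natDegree :=
        pow_le_pow_of_le_one (norm_nonneg _) h1 (natDegree_le_of_dvd hdvd hg.ne_zero)
    _ ≤ _ := by gcongr

theorem norm_natCast_eq_one_of_not_dvd {N : ℕ} (h : ¬ p ∣ N) : ‖(N : PadicAlgCl p)‖ = 1 := by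
  rw [← map_natCast (algebraMap ℚ_[p] (PadicAlgCl p)), PadicAlgCl.norm_extends]
  exact Padic.norm_natCast_eq_one_iff.2 ((Fact.out : p.Prime).coprime_iff_not_dvd.2 h)

/-- Given `π₀, π₁, … ∈ F` of increasing norms,
every integral element annihilated by a monic integral
polynomial of degree `N` prime to `p` is close to an element with large discriminant. -/
theorem exists_norm_sub_le_of_natDegree {f : F[X]} (hm : f.Monic)
    (hfc : ∀ i, ‖algebraMap F (PadicAlgCl p) (f.coeff i)‖ ≤ 1) (hN : ¬ p ∣ f.natDegree)
      {y : PadicAlgCl p}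
    (hy : aeval y f = 0) (t : ℕ → F) (ht : StrictMono fun k => ‖algebraMap F (PadicAlgCl p) (t k)‖)
    (ht1 : ∀ k, ‖algebraMap F (PadicAlgCl p) (t k)‖ < 1) (k₀ : ℕ) :
    ∃ z : PadicAlgCl p, ‖z‖ ≤ 1 ∧
      ‖y - z‖ ^ f.natDegree ≤ ‖algebraMap F (PadicAlgCl p) (t (k₀ + f.natDegree))‖ ∧
      (‖algebraMap F (PadicAlgCl p) (t k₀)‖ ^ (f.natDegree - 1)) ^ f.natDegree ≤
      ‖algebraMap F (PadicAlgCl p) (Algebra.discr F fun i : Fin (Module.finrank F F⟮z⟯) =>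
        AdjoinSimple.gen F z ^ (i : ℕ))‖ := by
  classical
  have := charZero_tower p F
  set v := algebraMap F (PadicAlgCl p) with hv
  have hN0 : f.natDegree ≠ 0 := fun h => hN (by simp [h])
  have hfN : (f.map v).natDegree = f.natDegree := natDegree_map _
  -- Pigeonhole: N distinct norms |t_k₀|, …, |t_(k₀+N-1)| are available, while the derivative has at
  -- most N - 1 roots, so one of them avoids all norms of critical values.
  obtain ⟨r, hr, hr'⟩ := Finset.exists_mem_notMem_of_card_lt_card
    (s := (derivative (f.map v)).roots.toFinset.image fun ξ => ‖(f.map v).eval ξ‖)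
    (t := (Finset.range f.natDegree).image fun k => ‖v (t (k₀ + k))‖) (by
      rw [Finset.card_image_of_injective (Finset.range f.natDegree)
        (show Function.Injective fun k => ‖v (t (k₀ + k))‖ from
          ht.injective.comp (add_right_injective k₀)), Finset.card_range]
      calc _ ≤ (derivative (f.map v)).roots.card :=
            Finset.card_image_le.trans (Multiset.toFinset_card_le _)
        _ ≤ f.natDegree - 1 := by
            rw [← hfN]
            exact (card_roots' _).trans (natDegree_derivative_le _)
        _ < f.natDegree := by omega)
  obtain ⟨k, hk, rfl⟩ := Finset.mem_image.1 hr
  rw [Finset.mem_range] at hk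
  obtain ⟨z, hz, hz1, hyz, hder⟩ := exists_separated_root_near (f := f.map v) (hm.map _)
    (by rw [hfN]; exact norm_natCast_eq_one_of_not_dvd hN) (by simpa using hfc)
    (y := y) (c := v (t (k₀ + k))) (by rwa [eval_map_algebraMap]) (ht1 _).le
    (fun ξ hξ h => hr' (Finset.mem_image.2 ⟨ξ, Multiset.mem_toFinset.2 hξ, h⟩))
  rw [hfN] at hyz hder
  refine ⟨z, hz1, hyz.trans (ht.monotone (by omega)), ?_⟩
  have hgm : (f - C (t (k₀ + k))).Monic := hm.sub_of_left
    (degree_C_le.trans_lt (natDegree_pos_iff_degree_pos.1 (Nat.pos_of_ne_zero hN0)))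
  have hgN : (f - C (t (k₀ + k))).natDegree = f.natDegree := natDegree_sub_C
  have hle := le_norm_discr_adjoin hgm (fun i => by
    rw [coeff_sub, map_sub]
    refine norm_sub_le_of_le_of_le (hfc i) ?_
    rw [coeff_C]
    split_ifs
    · exact (ht1 _).le
    · simp) hz1 (by
    rw [eval_map_algebraMap] at hz
    rw [map_sub, hz, aeval_C, sub_self])
  refine le_trans ?_ hle
  rw [hgN, derivative_sub, derivative_C, sub_zero]
  rw [derivative_map, eval_map_algebraMap] at hder
  gcongr
  refine le_trans ?_ hder
  gcongr
  exact ht.monotone (by omega)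

end PadicGalois

/-! ### Almost purity by iterated approximation -/

namespace PadicGalois

open Polynomial IntermediateField Filter

variable {p : ℕ} [Fact p.Prime]
variable {F : Type*} [Field F] [Algebra ℚ_[p] F] [Algebra F (PadicAlgCl p)]
    [IsScalarTower ℚ_[p] F (PadicAlgCl p)]

/-- A sequence of elements whose norms are less than one and increase to one. -/
structure IsNormSeq (π : ℕ → PadicAlgCl p) : Prop where
  strictMono : StrictMono fun k => ‖π k‖
  lt_one : ∀ k, ‖π k‖ < 1
  tendsto : Tendsto (fun k => ‖π k‖) atTop (nhds 1)

theorem IsNormSeq.normsNearOne {π : ℕ → PadicAlgCl p} (h : IsNormSeq π)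
    (hF : ∀ k, ∃ t : F, algebraMap F (PadicAlgCl p) t = π k) : NormsNearOne p F := by
  intro r hr
  obtain ⟨k, hk⟩ := (h.tendsto.eventually (lt_mem_nhds hr)).exists
  obtain ⟨t, ht⟩ := hF k
  exact ⟨t, by rwa [ht], by rw [ht]; exact h.lt_one k⟩

theorem IsNormSeq.exists_lt_pow {π : ℕ → PadicAlgCl p} (h : IsNormSeq π) {r : ℝ} (hr : r < 1)
    (n : ℕ) :
    ∃ k, r < ‖π k‖ ^ n := by
  have h1 : Tendsto (fun k => ‖π k‖ ^ n) atTop (nhds (1 ^ n)) := h.tendsto.pow n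
  rw [one_pow] at h1
  exact (h1.eventually (lt_mem_nhds hr)).exists

/-- An integral element of degree at most `d` over `F` is close, with a bound which only depends
on `d`, to an element which generates an almost unramified extension. -/
theorem exists_almostTrace_near {π : ℕ → PadicAlgCl p} (hπ : IsNormSeq π) (d : ℕ) :
    ∃ j, ∀ (F : Type) [Field F] [Algebra ℚ_[p] F] [Algebra F (PadicAlgCl p)]
      [IsScalarTower ℚ_[p] F (PadicAlgCl p)], FrobSurj p F →
      (∀ k, ∃ t : F, algebraMap F (PadicAlgCl p) t = π k) → ∀ y : PadicAlgCl p, ‖y‖ ≤ 1 →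
      (minpoly F y).natDegree ≤ d →
      ∃ z : PadicAlgCl p, ‖y - z‖ ≤ ‖π j‖ ∧ FrobSurj p F⟮z⟯ ∧ AlmostTrace F⟮z⟯ := by
  -- For an auxiliary polynomial of degree N ≤ d + 1 the discriminant is at least |π_k₀|^((N-1)N),
  -- and its p-th power must exceed |p|; this fixes k₀. Then j is chosen so that |y - z|^N ≤
  -- |π_(k₀+N)| forces |y - z| ≤ |π_j|. Neither choice depends on F.
  obtain ⟨k₀, hk₀⟩ := hπ.exists_lt_pow (norm_natCast_p_lt_one (p := p)) ((d + 1) * (d + 1) * p)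
  obtain ⟨j, hj⟩ := hπ.exists_lt_pow (hπ.lt_one (k₀ + (d + 1))) (d + 1)
  refine ⟨j, fun F _ _ _ _ hF ht y hy hd => ?_⟩
  choose t ht using ht
  have hyi := isIntegral_tower F y
  obtain ⟨f, hfm, hfc, hfN, hfd, hfy⟩ : ∃ f : F[X], f.Monic ∧
      (∀ i, ‖algebraMap F (PadicAlgCl p) (f.coeff i)‖ ≤ 1) ∧ ¬ p ∣ f.natDegree ∧ f.natDegree ≤ d +
        1 ∧
      aeval y f = 0 := by
    -- If p divides the degree, a factor X makes the degree prime to p at the cost of one, hence the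
    -- bounds with d + 1.
    by_cases hp : p ∣ (minpoly F y).natDegree
    · refine ⟨X * minpoly F y, monic_X.mul (minpoly.monic hyi), fun i => ?_, ?_, ?_, ?_⟩
      · cases i with
        | zero => simp
        | succ i =>
          rw [coeff_X_mul]
          exact norm_coeff_minpoly_le_one hy i
      · rw [natDegree_X_mul (minpoly.ne_zero hyi)]
        intro h
        exact (Fact.out : p.Prime).one_lt.ne' (Nat.dvd_one.1 ((Nat.dvd_add_right hp).1 h))
      · rw [natDegree_X_mul (minpoly.ne_zero hyi)]
        omega
      · simp
    · exact ⟨minpoly F y, minpoly.monic hyi, norm_coeff_minpoly_le_one hy, hp, by omega,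
        minpoly.aeval F y⟩
  obtain ⟨z, hz1, hyz, hD⟩ := exists_norm_sub_le_of_natDegree hfm hfc hfN hfy t
    (by simpa only [ht] using hπ.strictMono) (by simpa only [ht] using hπ.lt_one) k₀
  simp only [ht] at hyz hD
  have hfin : FiniteDimensional F F⟮z⟯ := adjoin.finiteDimensional (isIntegral_tower F z)
  have hN0 : f.natDegree ≠ 0 := fun h => hfN (by simp [h])
  have hdisc : ‖(p : PadicAlgCl p)‖ < ‖algebraMap F (PadicAlgCl p)
      (Algebra.discr F fun i : Fin (Module.finrank F F⟮z⟯) =>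
        AdjoinSimple.gen F z ^ (i : ℕ))‖ ^ p := by
    refine hk₀.trans_le ?_
    rw [pow_mul]
    gcongr
    refine le_trans ?_ hD
    rw [← pow_mul]
    refine pow_le_pow_of_le_one (norm_nonneg _) (hπ.lt_one _).le ?_
    gcongr
    omega
  have hn := hπ.normsNearOne (F := F) fun k => ⟨t k, ht k⟩
  refine ⟨z, ?_, hF.of_discr hn (z := AdjoinSimple.gen F z) hz1 hdisc,
    almostTrace_of_discr hF hn (z := AdjoinSimple.gen F z) hz1 hdisc⟩
  by_contra! hlt
  have h1 : ‖π j‖ ^ f.natDegree < ‖y - z‖ ^ f.natDegree :=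
    pow_lt_pow_left₀ hlt (norm_nonneg _) hN0
  have h2 : ‖π j‖ ^ (d + 1) ≤ ‖π j‖ ^ f.natDegree :=
    pow_le_pow_of_le_one (norm_nonneg _) (hπ.lt_one _).le hfd
  have h3 : ‖π (k₀ + f.natDegree)‖ ≤ ‖π (k₀ + (d + 1))‖ := hπ.strictMono.monotone (by omega)
  linarith

theorem AlmostTrace.trans {E : IntermediateField F (PadicAlgCl p)} [FiniteDimensional F E]
    {E' : IntermediateField E (PadicAlgCl p)} [FiniteDimensional E E'] (h : AlmostTrace E)
    (h' : AlmostTrace E') : AlmostTrace (E'.restrictScalars F) := by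
  intro ε hε
  -- For η ≤ 1, (1 + η)² ≤ 1 + 3η.
  set η := min (ε / 3) 1
  have hη : 0 < η := lt_min (by linarith) one_pos
  obtain ⟨a, ha, hna⟩ := h η hη
  obtain ⟨b, hb, hnb⟩ := h' η hη
  refine ⟨(a • b : E'), ?_, ?_⟩
  · have := Module.Free.of_divisionRing E E'
    change Algebra.trace F E' (a • b) = 1
    rw [← Algebra.trace_trace (S := E), map_smul, hb, smul_eq_mul, mul_one, ha]
  · change ‖(a : PadicAlgCl p) * (b : PadicAlgCl p)‖ ≤ 1 + ε
    rw [norm_mul]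
    calc _ ≤ (1 + η) * (1 + η) := by gcongr
      _ ≤ 1 + ε := by
        have h1 : η ≤ ε / 3 := min_le_left _ _
        have h2 : η ≤ 1 := min_le_right _ _
        nlinarith

theorem almostTrace_bot : AlmostTrace (⊥ : IntermediateField F (PadicAlgCl p)) := by
  intro ε hε
  refine ⟨1, ?_, by simp [hε.le]⟩
  rw [← map_one (algebraMap F (⊥ : IntermediateField F (PadicAlgCl p))), Algebra.trace_algebraMap]
  simp

theorem natDegree_minpoly_tower_le (E : IntermediateField F (PadicAlgCl p)) (y : PadicAlgCl p) :
    (minpoly E y).natDegree ≤ (minpoly F y).natDegree := by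
  have hy := isIntegral_tower F y
  refine (natDegree_le_of_dvd (minpoly.dvd_map_of_isScalarTower F E y)
    ((minpoly.monic hy).map _).ne_zero).trans ?_
  rw [natDegree_map]

theorem natDegree_minpoly_le_of_mem {x y : PadicAlgCl p} (h : x ∈ F⟮y⟯) :
    (minpoly F x).natDegree ≤ (minpoly F y).natDegree := by
  have hy := isIntegral_tower F y
  have := adjoin.finiteDimensional hy
  rw [← adjoin.finrank (isIntegral_tower F x), ← adjoin.finrank hy]
  have hle : F⟮x⟯ ≤ F⟮y⟯ := adjoin_simple_le_iff.2 h
  exact LinearMap.finrank_le_finrank_of_injective (f := (inclusion hle).toLinearMap)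
    (inclusion hle).injective

/-- Once z approximates y, the rescaled error (y - z)/π_j is integral and lies in F(z)(y), so its
degree over F(z) is still at most d. The same j works over F(z), and each round gains a factor
|π_j|. -/
theorem exists_almostTrace_norm_sub_le {π : ℕ → PadicAlgCl p} (hπ : IsNormSeq π) (d : ℕ) :
    ∃ j, ∀ (n : ℕ) (F : Type) [Field F] [Algebra ℚ_[p] F] [Algebra F (PadicAlgCl p)]
      [IsScalarTower ℚ_[p] F (PadicAlgCl p)], FrobSurj p F →
      (∀ k, ∃ t : F, algebraMap F (PadicAlgCl p) t = π k) → ∀ y : PadicAlgCl p, ‖y‖ ≤ 1 →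
      (minpoly F y).natDegree ≤ d →
      ∃ E : IntermediateField F (PadicAlgCl p), FiniteDimensional F E ∧ AlmostTrace E ∧
        ∃ w ∈ E, ‖y - w‖ ≤ ‖π j‖ ^ n := by
  obtain ⟨j, hj⟩ := exists_almostTrace_near hπ d
  refine ⟨j, fun n => ?_⟩
  induction n with
  | zero =>
    intro F _ _ _ _ _ _ y hy _
    exact ⟨⊥, inferInstance, almostTrace_bot, 0, zero_mem _, by simpa⟩
  | succ n ih =>
    intro F _ _ _ _ hF ht y hy hd
    obtain ⟨z, hyz, hE, htr⟩ := hj F hF ht y hy hd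
    have hfin : FiniteDimensional F F⟮z⟯ := adjoin.finiteDimensional (isIntegral_tower F z)
    have htE : ∀ k, ∃ t : F⟮z⟯, algebraMap F⟮z⟯ (PadicAlgCl p) t = π k := fun k => by
      obtain ⟨t, h⟩ := ht k
      exact ⟨algebraMap F F⟮z⟯ t, h⟩
    obtain ⟨s', hs'⟩ := htE j
    by_cases hπ0 : π j = 0
    · refine ⟨F⟮z⟯, hfin, htr, z, mem_adjoin_simple_self F z, ?_⟩
      rw [hπ0, norm_zero] at hyz
      rw [hπ0, norm_zero, zero_pow (Nat.succ_ne_zero n)]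
      exact hyz
    obtain ⟨E', hfin', htr', w, hw, hyw⟩ := ih F⟮z⟯ hE htE ((y - z) / π j)
      (by
        rw [norm_div]
        exact div_le_one_of_le₀ hyz (norm_nonneg _))
      (by
        refine le_trans (natDegree_minpoly_le_of_mem ?_)
          ((natDegree_minpoly_tower_le F⟮z⟯ y).trans hd)
        refine div_mem (sub_mem (mem_adjoin_simple_self _ y) ?_) ?_
        · exact _root_.algebraMap_mem F⟮z⟯⟮y⟯ (AdjoinSimple.gen F z)
        · rw [← hs']
          exact _root_.algebraMap_mem F⟮z⟯⟮y⟯ s')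
    refine ⟨E'.restrictScalars F, ?_, htr.trans htr', z + π j * w, ?_, ?_⟩
    · have : FiniteDimensional F E' := FiniteDimensional.trans F F⟮z⟯ E'
      exact this
    · rw [mem_restrictScalars]
      refine add_mem (_root_.algebraMap_mem E' (AdjoinSimple.gen F z)) (mul_mem ?_ hw)
      rw [← hs']
      exact _root_.algebraMap_mem E' s'
    · have : y - (z + π j * w) = π j * ((y - z) / π j - w) := by
        field_simp
        ring
      rw [this, norm_mul, pow_succ']
      gcongr

/-- **Almost purity**: every element is contained in a finite extension of `F` with almost
surjective trace. -/
theorem FrobSurj.exists_almostTrace {π : ℕ → PadicAlgCl p} (hπ : IsNormSeq π)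
    {F : Type} [Field F] [Algebra ℚ_[p] F] [Algebra F (PadicAlgCl p)]
    [IsScalarTower ℚ_[p] F (PadicAlgCl p)] (hF : FrobSurj p F)
    (ht : ∀ k, ∃ t : F, algebraMap F (PadicAlgCl p) t = π k) (y : PadicAlgCl p) :
    ∃ E : IntermediateField F (PadicAlgCl p), FiniteDimensional F E ∧ AlmostTrace E ∧ y ∈ E := by
  classical
  have := charZero_tower p F
  wlog hy : ‖y‖ ≤ 1 generalizing y
  · obtain ⟨n, hn⟩ := exists_pow_lt_of_lt_one
      (show 0 < ‖y‖⁻¹ by rw [inv_pos]; push Not at hy; linarith) (norm_natCast_p_lt_one (p := p))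
    obtain ⟨E, h1, h2, h3⟩ := this ((p : PadicAlgCl p) ^ n * y) (by
      push Not at hy
      rw [norm_mul, norm_pow]
      calc _ ≤ ‖y‖⁻¹ * ‖y‖ := by gcongr
        _ = 1 := inv_mul_cancel₀ (by linarith))
    refine ⟨E, h1, h2, ?_⟩
    have h4 : y = ((p : PadicAlgCl p) ^ n)⁻¹ * ((p : PadicAlgCl p) ^ n * y) := by
      rw [inv_mul_cancel_left₀ (pow_ne_zero _ natCast_p_ne_zero)]
    rw [h4]
    exact mul_mem (inv_mem (pow_mem (_root_.natCast_mem E p) n)) h3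
  obtain ⟨j, hj⟩ := exists_almostTrace_norm_sub_le hπ (minpoly F y).natDegree
  -- Krasner's argument: w in E will be nearer to y than any other conjugate of y. Were y outside E,
  -- y - w would have another conjugate over E, of the same norm; adding w gives a conjugate of y
  -- that is too close.
  have hev : ∀ᶠ n in atTop, ∀ y' ∈ ((minpoly F y).aroots (PadicAlgCl p)).toFinset.erase y,
      ‖π j‖ ^ n < ‖y - y'‖ := by
    rw [Filter.eventually_all_finset]
    intro y' hy'
    exact (tendsto_pow_atTop_nhds_zero_of_lt_one (norm_nonneg _) (hπ.lt_one j)).eventually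
      (gt_mem_nhds (norm_pos_iff.2 (sub_ne_zero.2 (Finset.ne_of_mem_erase hy').symm)))
  obtain ⟨n, hn⟩ := hev.exists
  obtain ⟨E, hfin, htr, w, hw, hyw⟩ := hj n F hF ht y hy le_rfl
  refine ⟨E, hfin, htr, ?_⟩
  by_contra hyE
  have := charZero_tower p E
  set w' : E := ⟨w, hw⟩
  have hz : y - w ∉ (⊥ : Subalgebra E (PadicAlgCl p)) := by
    rw [Algebra.mem_bot]
    rintro ⟨x, hx⟩
    apply hyE
    have : y = x + w := by
      rw [← sub_eq_iff_eq_add]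
      exact hx.symm
    rw [this]
    exact add_mem x.2 hw
  have hint := isIntegral_tower E (y - w)
  obtain ⟨z', hne, hconj⟩ := (notMem_iff_exists_ne_and_isConjRoot
    (minpoly.irreducible hint).separable (IsAlgClosed.splits _)).1 hz
  have hnz : ‖z'‖ = ‖y - w‖ := norm_root_minpoly hconj.aeval_eq_zero
  have hconj' : IsConjRoot F y (z' + w) := by
    refine IsConjRoot.of_isScalarTower (L := E) (isIntegral_tower F y) ?_
    have := IsConjRoot.add_algebraMap w' hconj
    rwa [show algebraMap E (PadicAlgCl p) w' = w from rfl, sub_add_cancel] at this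
  have hlt := hn (z' + w) (Finset.mem_erase.2 ⟨fun h => hne (by
      rw [← h, add_sub_cancel_right]), by
    rw [Multiset.mem_toFinset, mem_aroots]
    exact ⟨minpoly.ne_zero (isIntegral_tower F y), hconj'.aeval_eq_zero⟩⟩)
  have h5 : ‖y - (z' + w)‖ ≤ ‖y - w‖ := by
    rw [show y - (z' + w) = (y - w) - z' by ring]
    exact norm_sub_le_of_le_of_le le_rfl hnz.le
  linarith

end PadicGalois

/-! ### Frobenius on the cyclotomic tower -/

/-- When nonzero terms have distinct norms, the largest one cannot be cancelled. -/
theorem IsUltrametricDist.norm_le_norm_sum_of_injOn {M ι : Type*} [NormedAddCommGroup M]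
    [IsUltrametricDist M] (s : Finset ι) (f : ι → M)
    (h : ∀ i ∈ s, ∀ j ∈ s, f i ≠ 0 → ‖f i‖ = ‖f j‖ → i = j) :
    ∀ i ∈ s, ‖f i‖ ≤ ‖∑ j ∈ s, f j‖ := by
  classical
  intro i hi
  obtain ⟨k, hk, hmax⟩ := s.exists_max_image (fun j => ‖f j‖) ⟨i, hi⟩
  refine (hmax i hi).trans ?_
  by_cases h0 : f k = 0
  · simp [h0]
  have hlt : ‖∑ j ∈ s.erase k, f j‖ < ‖f k‖ := by
    rcases (s.erase k).eq_empty_or_nonempty with he | hne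
    · simpa [he] using h0
    · obtain ⟨j, hj, hle⟩ :=
        IsUltrametricDist.exists_norm_finsetSum_le_of_nonempty hne f
      refine hle.trans_lt (lt_of_le_of_ne (hmax j (Finset.mem_of_mem_erase hj)) fun heq => ?_)
      exact Finset.ne_of_mem_erase hj (h k hk j (Finset.mem_of_mem_erase hj) h0 heq.symm).symm
  rw [← Finset.add_sum_erase s f hk, IsUltrametricDist.norm_add_eq_max_of_norm_ne_norm hlt.ne',
    max_eq_left hlt.le]

namespace PadicGalois

open Polynomial IntermediateField Filter

variable {p : ℕ} [Fact p.Prime]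

theorem norm_one_sub_pow_le {ζ : PadicAlgCl p} (hζ : ‖ζ‖ = 1) (i : ℕ) : ‖1 - ζ ^ i‖ ≤ ‖1 - ζ‖ := by
  have h := norm_eval_sub_eval_le (f := (X : (PadicAlgCl p)[X]) ^ i) (fun j => by
    rw [coeff_X_pow]; split_ifs <;> simp) (x := 1) (y := ζ) (by simp) hζ.le
  simpa using h

theorem norm_eq_one_of_pow_eq_one' {ζ : PadicAlgCl p} {n : ℕ} (hn : n ≠ 0) (h : ζ ^ n = 1) :
    ‖ζ‖ = 1 := by
  have h1 : ‖ζ‖ ^ n = 1 := by rw [← norm_pow, h, norm_one]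
  exact (pow_eq_one_iff_of_nonneg (norm_nonneg _) hn).1 h1

/-- The product of 1 - μ over all primitive roots μ is Φ(1) = p. All factors have equal norm, as
primitive roots are powers of one another and 1 - ζ divides 1 - ζ^i. -/
theorem norm_one_sub_primitiveRoot {ζ : PadicAlgCl p} {n : ℕ}
    (hζ : IsPrimitiveRoot ζ (p ^ (n + 1))) :
    ‖1 - ζ‖ ^ (p ^ (n + 1)).totient = ‖(p : PadicAlgCl p)‖ := by
  have hp0 : p ^ (n + 1) ≠ 0 := pow_ne_zero _ (Fact.out : p.Prime).ne_zero
  have : NeZero (p ^ (n + 1)) := ⟨hp0⟩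
  have key : ∀ {a b : PadicAlgCl p}, IsPrimitiveRoot a (p ^ (n + 1)) →
      IsPrimitiveRoot b (p ^ (n + 1)) →
      ‖1 - b‖ ≤ ‖1 - a‖ := fun {a b} ha hb => by
    obtain ⟨i, -, rfl⟩ := ha.eq_pow_of_pow_eq_one hb.pow_eq_one
    exact norm_one_sub_pow_le (norm_eq_one_of_pow_eq_one' hp0 ha.pow_eq_one) i
  have h1 := congrArg (eval 1) (cyclotomic_eq_prod_X_sub_primitiveRoots hζ)
  rw [eval_one_cyclotomic_prime_pow, eval_prod] at h1
  rw [h1, norm_prod, ← hζ.card_primitiveRoots, ← Finset.prod_const]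
  refine Finset.prod_congr rfl fun μ hμ => ?_
  have hμ' := (mem_primitiveRoots (Nat.pos_of_ne_zero hp0)).1 hμ
  simpa using le_antisymm (key hμ' hζ) (key hζ hμ')

/-- The element π behaves as a uniformizer of ramification index N: the terms c_i π^i have
valuations congruent to i modulo N, in units of 1/N, so they are pairwise distinct. -/
theorem norm_algebraMap_mul_pow_le {N : ℕ} {π : PadicAlgCl p} (hπ : ‖π‖ ^ N = ‖(p : PadicAlgCl p)‖)
    {f : ℚ_[p][X]}
    (hf : f.natDegree < N) {i : ℕ} (hi : i < N) :
    ‖algebraMap ℚ_[p] (PadicAlgCl p) (f.coeff i) * π ^ i‖ ≤ ‖aeval π f‖ := by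
  have hpR : (1 : ℝ) < p := by exact_mod_cast (Fact.out : p.Prime).one_lt
  have hpow : ∀ i, f.coeff i ≠ 0 → ‖algebraMap ℚ_[p] (PadicAlgCl p) (f.coeff i) * π ^ i‖ ^ N =
      (p : ℝ) ^ (-((f.coeff i).valuation * N + i)) := fun i h => by
    rw [norm_mul, PadicAlgCl.norm_extends, Padic.norm_eq_zpow_neg_valuation h, norm_pow, mul_pow,
      ← pow_mul, mul_comm i N, pow_mul, hπ, norm_natCast_p, ← zpow_natCast, ← zpow_mul, neg_add,
      zpow_add₀ (by positivity), neg_mul, zpow_neg _ (i : ℤ), zpow_natCast, inv_pow]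
  rw [aeval_eq_sum_range' hf]
  simp_rw [Algebra.smul_def]
  refine IsUltrametricDist.norm_le_norm_sum_of_injOn (Finset.range N)
    (fun i => algebraMap ℚ_[p] (PadicAlgCl p) (f.coeff i) * π ^ i) (fun i hi j hj h0 heq => ?_) i
    (Finset.mem_range.2 hi)
  have hj0 : algebraMap ℚ_[p] (PadicAlgCl p) (f.coeff j) * π ^ j ≠ 0 := by
    rw [← norm_ne_zero_iff, ← heq, norm_ne_zero_iff]
    exact h0
  have hci : f.coeff i ≠ 0 := fun h => h0 (by simp [h])
  have hcj : f.coeff j ≠ 0 := fun h => hj0 (by simp [h])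
  have h1 := hpow i hci
  rw [heq, hpow j hcj] at h1
  have h2 := zpow_right_injective₀ (by linarith) hpR.ne' h1
  rw [neg_inj] at h2
  rw [Finset.mem_range] at hi hj
  have h3 := congrArg (· % (N : ℤ)) h2
  simp only [Int.mul_add_emod_self_right] at h3
  rw [Int.emod_eq_of_lt (by omega) (by omega), Int.emod_eq_of_lt (by omega) (by omega)] at h3
  omega

/-- The integral elements of the field generated by a primitive `p ^ (n + 1)`-th root of unity `ζ`
are polynomials in `1 - ζ` with integral coefficients. -/
theorem exists_integral_aeval_eq {ζ : PadicAlgCl p} {n : ℕ} (hζ : IsPrimitiveRoot ζ (p ^ (n + 1)))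
    {a : PadicAlgCl p} (ha : a ∈ ℚ_[p]⟮ζ⟯) (ha1 : ‖a‖ ≤ 1) :
    ∃ f : ℚ_[p][X], (∀ i, ‖f.coeff i‖ ≤ 1) ∧ aeval (1 - ζ) f = a := by
  set N := (p ^ (n + 1)).totient with hN
  have hp0 : 0 < p ^ (n + 1) := pow_pos (Fact.out : p.Prime).pos _
  have hN0 : N ≠ 0 := (Nat.totient_pos.2 hp0).ne'
  have hπ := norm_one_sub_primitiveRoot hζ
  set π : PadicAlgCl p := 1 - ζ with hπdef
  have hint : IsIntegral ℚ_[p] π := Algebra.IsIntegral.isIntegral π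
  have ha' : a ∈ ℚ_[p]⟮π⟯ := by
    have hle : ℚ_[p]⟮ζ⟯ ≤ ℚ_[p]⟮π⟯ := by
      rw [adjoin_simple_le_iff, show ζ = 1 - π by rw [hπdef]; ring]
      exact sub_mem (one_mem _) (mem_adjoin_simple_self _ _)
    exact hle ha
  let pb := adjoin.powerBasis hint
  have hdim : pb.dim ≤ N := by
    rw [adjoin.powerBasis_dim]
    have hroot : aeval π ((cyclotomic (p ^ (n + 1)) ℚ_[p]).comp (1 - X)) = 0 := by
      rw [aeval_comp]
      have h1 : aeval π (1 - X : ℚ_[p][X]) = ζ := by simp [hπdef]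
      rw [h1, ← eval_map_algebraMap, map_cyclotomic]
      exact hζ.isRoot_cyclotomic hp0
    have hdeg : (1 - X : ℚ_[p][X]).natDegree = 1 := by
      rw [show (1 - X : ℚ_[p][X]) = -(X - C 1) by simp, natDegree_neg, natDegree_X_sub_C]
    have hcd : ((cyclotomic (p ^ (n + 1)) ℚ_[p]).comp (1 - X)).natDegree = N := by
      rw [natDegree_comp, natDegree_cyclotomic, hdeg, mul_one]
    have hne : (cyclotomic (p ^ (n + 1)) ℚ_[p]).comp (1 - X) ≠ 0 := fun h => by
      rw [h, natDegree_zero] at hcd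
      exact hN0 hcd.symm
    exact (natDegree_le_of_dvd (minpoly.dvd _ _ hroot) hne).trans_eq hcd
  obtain ⟨f, hfd, hf⟩ := pb.exists_eq_aeval ⟨a, ha'⟩
  have hfa : aeval π f = a := by
    have := congrArg (algebraMap ℚ_[p]⟮π⟯ (PadicAlgCl p)) hf
    rw [adjoin.powerBasis_gen, ← aeval_algebraMap_apply] at this
    exact this.symm
  refine ⟨f, fun i => ?_, hfa⟩
  rcases lt_or_ge i N with hi | hi
  · have h1 := norm_algebraMap_mul_pow_le hπ (hfd.trans_le hdim) hi
    rw [hfa, norm_mul, PadicAlgCl.norm_extends, norm_pow] at h1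
    have hπ1 : ‖π‖ < 1 := by
      by_contra! h
      exact absurd (one_le_pow₀ h (n := N)) (by rw [hπ]; exact not_le.2 norm_natCast_p_lt_one)
    have hπ0 : 0 < ‖π‖ := by
      refine (norm_nonneg _).lt_of_ne fun h => ?_
      rw [← h, zero_pow hN0] at hπ
      exact norm_natCast_p_pos.ne hπ
    have h2 : ‖π‖ ^ N < ‖π‖ ^ i := pow_lt_pow_right_of_lt_one₀ hπ0 hπ1 hi
    rw [hπ, norm_natCast_p] at h2
    have hp1 : (0 : ℝ) < p := by exact_mod_cast (Fact.out : p.Prime).pos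
    -- From |c| |π|^i ≤ 1 and |π|^i > |π|^N = 1/p one gets |c| < p, and |c| ≤ 1 follows because
    -- norms on Q_p are powers of p.
    have h3 : ‖f.coeff i‖ < (p : ℝ) ^ (0 + 1 : ℤ) := by
      rw [zero_add, zpow_one]
      by_contra! hge
      have h4 : (p : ℝ) * (p : ℝ)⁻¹ < ‖f.coeff i‖ * ‖π‖ ^ i :=
        mul_lt_mul' hge h2 (by positivity) (by linarith)
      rw [mul_inv_cancel₀ hp1.ne'] at h4
      linarith [ha1]
    have h4 := (Padic.norm_le_pow_iff_norm_lt_pow_add_one _ _).2 h3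
    simpa using h4
  · rw [coeff_eq_zero_of_natDegree_lt (by omega)]
    simp

theorem norm_padic_pow_sub_le {x : ℚ_[p]} (hx : ‖x‖ ≤ 1) :
    ‖algebraMap ℚ_[p] (PadicAlgCl p) x ^ p - algebraMap ℚ_[p] (PadicAlgCl p) x‖ ≤
      ‖(p : PadicAlgCl p)‖ := by
  set y : ℤ_[p] := ⟨x, hx⟩ with hy
  have h1 : ‖y ^ p - y‖ < 1 := by
    rw [← PadicInt.mem_nonunits, ← IsLocalRing.mem_maximalIdeal, ← PadicInt.ker_toZMod,
      RingHom.mem_ker]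
    simp
  have h2 : ‖x ^ p - x‖ < (p : ℝ) ^ (-1 + 1 : ℤ) := by
    rw [neg_add_cancel, zpow_zero]
    rwa [PadicInt.norm_def, PadicInt.coe_sub, PadicInt.coe_pow] at h1
  rw [← map_pow, ← map_sub, PadicAlgCl.norm_extends, norm_natCast_p]
  simpa using (Padic.norm_le_pow_iff_norm_lt_pow_add_one _ _).2 h2

/-- If a = f(1 - ζ) with f integral over Z_p, then f(1 - ξ)^p ≡ f(1 - ζ) modulo p: Frobenius fixes
the coefficients by Fermat and sends 1 - ξ to 1 - ζ. -/
theorem exists_norm_sub_pow_le_of_mem_adjoin {ζ ξ : PadicAlgCl p} {n : ℕ}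
    (hζ : IsPrimitiveRoot ζ (p ^ (n + 1))) (hξ : ξ ^ p = ζ) {a : PadicAlgCl p} (ha : a ∈ ℚ_[p]⟮ζ⟯)
    (ha1 : ‖a‖ ≤ 1) : ∃ b ∈ ℚ_[p]⟮ξ⟯, ‖a - b ^ p‖ ≤ ‖(p : PadicAlgCl p)‖ := by
  have hp0 : p ≠ 0 := (Fact.out : p.Prime).ne_zero
  obtain ⟨f, hf, rfl⟩ := exists_integral_aeval_eq hζ ha ha1
  have hξ1 : ‖ξ‖ ≤ 1 := by
    refine (norm_eq_one_of_pow_eq_one' (n := p * p ^ (n + 1)) (by positivity) ?_).le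
    rw [pow_mul, hξ, hζ.pow_eq_one]
  have hζ1 : ‖ζ‖ ≤ 1 := (norm_eq_one_of_pow_eq_one' (by positivity) hζ.pow_eq_one).le
  have hξ1' : ‖1 - ξ‖ ≤ 1 := norm_sub_le_of_le_of_le (by simp) hξ1
  have hζ1' : ‖1 - ζ‖ ≤ 1 := norm_sub_le_of_le_of_le (by simp) hζ1
  have hfr : ‖(1 - ζ) - (1 - ξ) ^ p‖ ≤ ‖(p : PadicAlgCl p)‖ := by
    have h := norm_add_pow_sub_le (p := p) natCast_p_ne_zero norm_natCast_p_lt_one hξ1' hξ1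
    rw [sub_add_cancel, one_pow, hξ] at h
    rwa [show 1 - ζ - (1 - ξ) ^ p = 1 - ((1 - ξ) ^ p + ζ) by ring]
  refine ⟨aeval (1 - ξ) f, ?_, ?_⟩
  · rw [aeval_eq_sum_range]
    refine sum_mem fun i _ => ?_
    rw [Algebra.smul_def]
    exact mul_mem (IntermediateField.algebraMap_mem _ _)
      (pow_mem (sub_mem (one_mem _) (mem_adjoin_simple_self _ _)) _)
  · rw [aeval_eq_sum_range, aeval_eq_sum_range]
    simp_rw [Algebra.smul_def]
    have hc : ∀ i, ‖algebraMap ℚ_[p] (PadicAlgCl p) (f.coeff i)‖ ≤ 1 := fun i => by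
      rw [PadicAlgCl.norm_extends]; exact hf i
    have h1 := norm_sum_pow_sub_le (p := p) natCast_p_ne_zero norm_natCast_p_lt_one
      (Finset.range (f.natDegree + 1))
      (fun i => algebraMap ℚ_[p] (PadicAlgCl p) (f.coeff i) * (1 - ξ) ^ i) (fun i => by
        rw [norm_mul, norm_pow]
        exact mul_le_one₀ (hc i) (by positivity) (pow_le_one₀ (norm_nonneg _) hξ1'))
    rw [norm_sub_rev] at h1
    refine norm_sub_le_trans ?_ h1
    rw [← Finset.sum_sub_distrib]
    refine IsUltrametricDist.norm_sum_le_of_forall_le_of_nonneg (norm_nonneg _) fun i _ => ?_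
    have h2 := norm_pow_sub_pow_le_of_le (p := p) natCast_p_ne_zero hζ1' (y := (1 - ξ) ^ p)
      (by rw [norm_pow]; exact pow_le_one₀ (norm_nonneg _) hξ1') hfr i
    have h3 := norm_padic_pow_sub_le (hf i)
    rw [norm_sub_rev] at h3
    rw [show algebraMap ℚ_[p] (PadicAlgCl p) (f.coeff i) * (1 - ζ) ^ i -
        (algebraMap ℚ_[p] (PadicAlgCl p) (f.coeff i) * (1 - ξ) ^ i) ^ p =
        algebraMap ℚ_[p] (PadicAlgCl p) (f.coeff i) * ((1 - ζ) ^ i - ((1 - ξ) ^ p) ^ i) +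
        (algebraMap ℚ_[p] (PadicAlgCl p) (f.coeff i) - algebraMap ℚ_[p] (PadicAlgCl p)
          (f.coeff i) ^ p) *
          ((1 - ξ) ^ p) ^ i by ring]
    refine (IsUltrametricDist.norm_add_le_max _ _).trans (max_le ?_ ?_)
    · rw [norm_mul]
      exact (mul_le_of_le_one_left (norm_nonneg _) (hc i)).trans h2
    · rw [norm_mul]
      refine (mul_le_of_le_one_right (norm_nonneg _) ?_).trans h3
      rw [norm_pow, norm_pow]
      exact pow_le_one₀ (by positivity) (pow_le_one₀ (norm_nonneg _) hξ1')

variable (p) in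
/-- The field obtained by adjoining all `p`-power roots of unity to `ℚ_[p]`. -/
def cycField : IntermediateField ℚ_[p] (PadicAlgCl p) :=
  adjoin ℚ_[p] {ζ : PadicAlgCl p | ∃ n : ℕ, ζ ^ p ^ n = 1}

theorem exists_primitiveRoot_prime_pow (p : ℕ) [Fact p.Prime] (n : ℕ) :
    ∃ ζ : PadicAlgCl p, IsPrimitiveRoot ζ (p ^ (n + 1)) :=
  have : NeZero p := ⟨(Fact.out : p.Prime).ne_zero⟩
  HasEnoughRootsOfUnity.exists_primitiveRoot (PadicAlgCl p) (p ^ (n + 1))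

variable (p) in
/-- A primitive `p ^ (n + 1)`-th root of unity. -/
def zetaPow (n : ℕ) : PadicAlgCl p := (exists_primitiveRoot_prime_pow p n).choose

theorem zetaPow_spec (n : ℕ) : IsPrimitiveRoot (zetaPow p n) (p ^ (n + 1)) :=
  (exists_primitiveRoot_prime_pow p n).choose_spec

theorem mem_adjoin_zetaPow {ξ : PadicAlgCl p} {m n : ℕ} (hmn : m ≤ n + 1) (h : ξ ^ p ^ m = 1) :
    ξ ∈ ℚ_[p]⟮zetaPow p n⟯ := by
  have : NeZero p := ⟨(Fact.out : p.Prime).ne_zero⟩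
  obtain ⟨i, -, rfl⟩ := (zetaPow_spec (p := p) n).eq_pow_of_pow_eq_one (ξ := ξ) (by
    rw [← Nat.add_sub_cancel' hmn, pow_add, pow_mul, h, one_pow])
  exact pow_mem (mem_adjoin_simple_self _ _) i

theorem exists_mem_adjoin_zetaPow {a : PadicAlgCl p} (ha : a ∈ cycField p) :
    ∃ n, a ∈ ℚ_[p]⟮zetaPow p n⟯ := by
  have hmono : ∀ {m n : ℕ}, m ≤ n → ℚ_[p]⟮zetaPow p m⟯ ≤ ℚ_[p]⟮zetaPow p n⟯ := fun {m n} h =>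
    adjoin_simple_le_iff.2 (mem_adjoin_zetaPow (m := m + 1) (by omega)
      (zetaPow_spec m).pow_eq_one)
  induction ha using adjoin_induction with
  | mem x hx =>
    obtain ⟨n, hn⟩ := hx
    exact ⟨n, mem_adjoin_zetaPow (by omega) hn⟩
  | algebraMap x => exact ⟨0, _root_.algebraMap_mem _ _⟩
  | add x y _ _ hx hy =>
    obtain ⟨m, hm⟩ := hx
    obtain ⟨n, hn⟩ := hy
    exact ⟨max m n, add_mem (hmono (le_max_left _ _) hm) (hmono (le_max_right _ _) hn)⟩
  | inv x _ hx =>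
    obtain ⟨m, hm⟩ := hx
    exact ⟨m, inv_mem hm⟩
  | mul x y _ _ hx hy =>
    obtain ⟨m, hm⟩ := hx
    obtain ⟨n, hn⟩ := hy
    exact ⟨max m n, mul_mem (hmono (le_max_left _ _) hm) (hmono (le_max_right _ _) hn)⟩

theorem frobSurj_cycField : FrobSurj p (cycField p) := by
  intro a ha
  obtain ⟨n, hn⟩ := exists_mem_adjoin_zetaPow a.2
  obtain ⟨ξ, hξ⟩ := IsAlgClosed.exists_pow_nat_eq (zetaPow p n) (Fact.out : p.Prime).pos
  obtain ⟨b, hb, hab⟩ := exists_norm_sub_pow_le_of_mem_adjoin (zetaPow_spec n) hξ hn ha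
  have hle : ℚ_[p]⟮ξ⟯ ≤ cycField p := by
    rw [adjoin_simple_le_iff]
    refine subset_adjoin _ _ ⟨n + 2, ?_⟩
    rw [pow_succ', pow_mul, hξ, (zetaPow_spec n).pow_eq_one]
  exact ⟨⟨b, hle hb⟩, hab⟩

theorem isNormSeq_one_sub_zetaPow : IsNormSeq fun n => 1 - zetaPow p n := by
  have hp1 := (Fact.out : p.Prime).one_lt
  set N : ℕ → ℕ := fun n => p ^ n * (p - 1) with hN
  have hpow : ∀ n, ‖1 - zetaPow p n‖ ^ N n = ‖(p : PadicAlgCl p)‖ := fun n => by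
    rw [← norm_one_sub_primitiveRoot (zetaPow_spec n), Nat.totient_prime_pow_succ Fact.out]
  have hNpos : ∀ n, 0 < N n := fun n => Nat.mul_pos (pow_pos (by omega) _) (by omega)
  have hlt : ∀ n, ‖1 - zetaPow p n‖ < 1 := fun n => by
    by_contra! h
    exact absurd (one_le_pow₀ h (n := N n)) (by rw [hpow]; exact not_le.2 norm_natCast_p_lt_one)
  have hpos : ∀ n, 0 < ‖1 - zetaPow p n‖ := fun n => by
    refine (norm_nonneg _).lt_of_ne fun h => ?_
    have := hpow n
    rw [← h, zero_pow (hNpos n).ne'] at this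
    exact norm_natCast_p_pos.ne this
  have hNlt : ∀ n, N n < N (n + 1) := fun n =>
    Nat.mul_lt_mul_of_pos_right (Nat.pow_lt_pow_right hp1 (by omega)) (by omega)
  refine ⟨strictMono_nat_of_lt_succ fun n => ?_, hlt, ?_⟩
  · by_contra! h
    have h1 : ‖1 - zetaPow p (n + 1)‖ ^ N (n + 1) ≤ ‖1 - zetaPow p n‖ ^ N (n + 1) := by gcongr
    have h2 : ‖1 - zetaPow p n‖ ^ N (n + 1) < ‖1 - zetaPow p n‖ ^ N n :=
      pow_lt_pow_right_of_lt_one₀ (hpos n) (hlt n) (hNlt n)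
    rw [hpow] at h1 h2
    linarith
  · refine tendsto_order.2 ⟨fun r hr => ?_, fun r hr => Eventually.of_forall fun n =>
      (hlt n).trans hr⟩
    rcases le_or_gt r 0 with h0 | h0
    · exact Eventually.of_forall fun n => h0.trans_lt (hpos n)
    have hNt : Tendsto N atTop atTop :=
      (strictMono_nat_of_lt_succ hNlt).tendsto_atTop
    filter_upwards [((tendsto_pow_atTop_nhds_zero_of_lt_one h0.le hr).comp hNt).eventually
      (gt_mem_nhds (norm_natCast_p_pos (p := p)))] with n hn
    by_contra! h
    have h1 : ‖1 - zetaPow p n‖ ^ N n ≤ r ^ N n := by gcongr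
    rw [hpow] at h1
    exact absurd hn (not_lt.2 h1)

/-- Every element of `ℚ̄_p` lies in a finite extension of `ℚ_p(μ_{p^∞})` over which the trace is
almost surjective. -/
theorem exists_almostTrace_cycField (y : PadicAlgCl p) :
    ∃ E : IntermediateField (cycField p) (PadicAlgCl p), FiniteDimensional (cycField p) E ∧
      AlmostTrace E ∧ y ∈ E :=
  frobSurj_cycField.exists_almostTrace isNormSeq_one_sub_zetaPow
    (fun n => ⟨⟨1 - zetaPow p n, sub_mem (one_mem _)
      (subset_adjoin _ _ ⟨n + 1, (zetaPow_spec n).pow_eq_one⟩)⟩, rfl⟩) y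

end PadicGalois

/-! ### Coset representatives -/

section Transversal

variable {Γ : Type*} [Group Γ] {ι κ : Type*}

/-- The family `s` is a system of representatives of the left cosets of `U` in `G`. -/
structure IsTransversal (G U : Subgroup Γ) (s : ι → Γ) : Prop where
  mem : ∀ i, s i ∈ G
  existsUnique : ∀ g ∈ G, ∃! i, (s i)⁻¹ * g ∈ U

namespace IsTransversal

variable {G V U : Subgroup Γ} {s : ι → Γ} {t : κ → Γ}

theorem exists_equiv (hs : IsTransversal G U s) (ht : IsTransversal G U t) :
    ∃ e : ι ≃ κ, ∀ i, (t (e i))⁻¹ * s i ∈ U := by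
  choose e he heu using fun i => ht.existsUnique (s i) (hs.mem i)
  choose e' he' heu' using fun j => hs.existsUnique (t j) (ht.mem j)
  refine ⟨⟨e, e', fun i => ?_, fun j => ?_⟩, he⟩
  · obtain ⟨k, hk, huk⟩ := hs.existsUnique (s i) (hs.mem i)
    have h1 : e' (e i) = k := huk _ (by
      have := U.mul_mem (he' (e i)) (he i)
      simpa [mul_assoc] using this)
    have h2 : i = k := huk _ (by simp)
    rw [h1, h2]
  · obtain ⟨k, hk, huk⟩ := ht.existsUnique (t j) (ht.mem j)
    have h1 : e (e' j) = k := huk _ (by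
      have := U.mul_mem (he (e' j)) (he' j)
      simpa [mul_assoc] using this)
    have h2 : j = k := huk _ (by simp)
    rw [h1, h2]

theorem sum_eq [Fintype ι] [Fintype κ] {A : Type*} [AddCommMonoid A] (hs : IsTransversal G U s)
    (ht : IsTransversal G U t) (f : Γ → A) (hf : ∀ g, ∀ u ∈ U, f (g * u) = f g) :
    ∑ i, f (s i) = ∑ j, f (t j) := by
  obtain ⟨e, he⟩ := hs.exists_equiv ht
  refine Fintype.sum_equiv e _ _ fun i => ?_
  rw [← hf (t (e i)) _ (he i), mul_inv_cancel_left]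

theorem mul_left (hs : IsTransversal G U s) {g : Γ} (hg : g ∈ G) :
    IsTransversal G U fun i => g * s i where
  mem i := G.mul_mem hg (hs.mem i)
  existsUnique x hx := by
    simpa [mul_assoc] using hs.existsUnique (g⁻¹ * x) (G.mul_mem (G.inv_mem hg) hx)

theorem mul (hs : IsTransversal G V s) (ht : IsTransversal V U t) (hUV : U ≤ V) (hVG : V ≤ G) :
    IsTransversal G U fun x : ι × κ => s x.1 * t x.2 where
  mem x := G.mul_mem (hs.mem _) (hVG (ht.mem _))
  existsUnique g hg := by
    obtain ⟨i, hi, hui⟩ := hs.existsUnique g hg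
    obtain ⟨j, hj, huj⟩ := ht.existsUnique _ hi
    refine ⟨(i, j), by simpa [mul_assoc] using hj, ?_⟩
    rintro ⟨i', j'⟩ h
    have h1 : (s i')⁻¹ * g ∈ V := by
      have := V.mul_mem (ht.mem j') (hUV h)
      simpa [mul_assoc] using this
    obtain rfl := hui _ h1
    obtain rfl := huj j' (by simpa [mul_assoc] using h)
    rfl

theorem relIndex_ne_zero [Finite ι] (hs : IsTransversal G U s) : U.relIndex G ≠ 0 := by
  have hsurj : Function.Surjective
      fun i => (QuotientGroup.mk (⟨s i, hs.mem i⟩ : G) : G ⧸ U.subgroupOf G) := by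
    intro q
    obtain ⟨g, rfl⟩ := QuotientGroup.mk_surjective q
    obtain ⟨i, hi, -⟩ := hs.existsUnique g g.2
    refine ⟨i, ?_⟩
    rw [QuotientGroup.eq]
    exact hi
  have : Finite (G ⧸ U.subgroupOf G) := Finite.of_surjective _ hsurj
  exact Subgroup.index_ne_zero_of_finite

end IsTransversal

theorem exists_isTransversal {Γ : Type*} [Group Γ] {G U : Subgroup Γ} (h : U.relIndex G ≠ 0) :
    ∃ (n : ℕ) (s : Fin n → Γ), n = U.relIndex G ∧ IsTransversal G U s := by
  have : (U.subgroupOf G).FiniteIndex := ⟨h⟩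
  have : Finite (G ⧸ U.subgroupOf G) := Subgroup.finite_quotient_of_finiteIndex
  obtain e : (G ⧸ U.subgroupOf G) ≃ Fin (U.relIndex G) := Finite.equivFin _
  refine ⟨_, fun i => ((e.symm i).out : G), rfl, fun i => SetLike.coe_mem _, fun g hg => ?_⟩
  refine ⟨e (QuotientGroup.mk ⟨g, hg⟩), ?_, fun i hi => ?_⟩
  · have : QuotientGroup.mk (s := U.subgroupOf G)
        (Quotient.out (QuotientGroup.mk (s := U.subgroupOf G) ⟨g, hg⟩)) =
        QuotientGroup.mk ⟨g, hg⟩ := QuotientGroup.out_eq' _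
    rw [QuotientGroup.eq] at this
    beta_reduce
    rw [e.symm_apply_apply]
    exact this
  · rw [← e.symm_apply_eq, ← QuotientGroup.out_eq' (e.symm i), QuotientGroup.eq]
    exact hi

end Transversal

/-! ### Traces as sums over cosets in the absolute Galois group -/

namespace PadicGalois

open Polynomial IntermediateField Filter

variable {p : ℕ} [Fact p.Prime]

theorem norm_galois (g : Gal(PadicAlgCl p/ℚ_[p])) (x : PadicAlgCl p) : ‖g x‖ = ‖x‖ :=
  norm_algHom (g : PadicAlgCl p →ₐ[ℚ_[p]] PadicAlgCl p) x

/-- The trace of a finite extension as a sum over a transversal in the absolute Galois group. -/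
theorem exists_isTransversal_trace {F : IntermediateField ℚ_[p] (PadicAlgCl p)}
    (E : IntermediateField F (PadicAlgCl p)) [FiniteDimensional F E] :
    ∃ (ι : Type) (_ : Fintype ι) (s : ι → Gal(PadicAlgCl p/ℚ_[p])),
      IsTransversal F.fixingSubgroup (E.restrictScalars ℚ_[p]).fixingSubgroup s ∧
      ∀ x : E, ∑ i, s i x = algebraMap F (PadicAlgCl p) (Algebra.trace F E x) := by
  have : Algebra.IsAlgebraic F (PadicAlgCl p) := isAlgebraic_tower F
  have : CharZero F := charZero_tower p F
  have : Normal F (PadicAlgCl p) := inferInstance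
  let S : (E →ₐ[F] PadicAlgCl p) → Gal(PadicAlgCl p/F) := fun φ =>
    AlgEquiv.ofBijective (φ.liftNormal (PadicAlgCl p)) (Algebra.IsAlgebraic.algHom_bijective _)
  have hS : ∀ φ : E →ₐ[F] PadicAlgCl p, ∀ x : E, S φ x = φ x :=
      fun φ x => φ.liftNormal_commutes (PadicAlgCl p) x
  refine ⟨E →ₐ[F] PadicAlgCl p, inferInstance, fun φ => (S φ).restrictScalars ℚ_[p], ⟨fun φ => ?_,
    fun g hg => ?_⟩, fun x => ?_⟩
  · rw [IntermediateField.mem_fixingSubgroup_iff]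
    intro x hx
    exact (S φ).commutes ⟨x, hx⟩
  · rw [IntermediateField.mem_fixingSubgroup_iff] at hg
    let g' : PadicAlgCl p →ₐ[F] PadicAlgCl p :=
      { (g : PadicAlgCl p →+* PadicAlgCl p) with commutes' := fun x => hg x x.2 }
    refine ⟨g'.comp E.val, ?_, fun φ hφ => ?_⟩
    · change _ ∈ _
      rw [IntermediateField.mem_fixingSubgroup_iff]
      intro x hx
      change (S (g'.comp E.val)).symm (g x) = x
      rw [AlgEquiv.symm_apply_eq]
      exact (hS (g'.comp E.val) ⟨x, hx⟩).symm
    · beta_reduce at hφ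
      rw [IntermediateField.mem_fixingSubgroup_iff] at hφ
      ext x
      have h1 : (S φ).symm (g x) = x := hφ x x.2
      rw [AlgEquiv.symm_apply_eq, hS] at h1
      exact h1.symm
  · rw [algebraMap_trace_eq_sum]
    exact Finset.sum_congr rfl fun φ _ => hS φ x

instance hasEnoughRootsOfUnity_prime_pow (i : ℕ) : HasEnoughRootsOfUnity (PadicAlgCl p) (p ^ i) :=
  have : NeZero p := ⟨(Fact.out : p.Prime).ne_zero⟩
  inferInstance

theorem cyclotomicCharacter_eq_one_iff (g : Gal(PadicAlgCl p/ℚ_[p])) :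
    cyclotomicCharacter (PadicAlgCl p) p (g : PadicAlgCl p ≃+* PadicAlgCl p) = 1 ↔ g ∈
      (cycField p).fixingSubgroup := by
  constructor
  · intro h
    have hle : cycField p ≤ fixedField (Subgroup.zpowers g) := by
      rw [cycField, adjoin_le_iff]
      rintro ζ ⟨n, hn⟩
      have h1 := cyclotomicCharacter.spec p (g : PadicAlgCl p ≃+* PadicAlgCl p) ζ hn
      have h2 : g ζ = ζ := by
        rw [h, Units.val_one, map_one] at h1
        have h3 : ζ ^ (1 : ZMod (p ^ n)).val = ζ := by
          rcases Nat.eq_zero_or_pos n with rfl | hn0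
          · rw [pow_zero, pow_one] at hn
            rw [hn, one_pow]
          · have : Fact (1 < p ^ n) :=
              ⟨Nat.one_lt_pow hn0.ne' (Fact.out : p.Prime).one_lt⟩
            rw [ZMod.val_one, pow_one]
        rw [h3] at h1
        exact h1
      rw [SetLike.mem_coe, mem_fixedField_iff]
      intro f hf
      have hz : Subgroup.zpowers g ≤ MulAction.stabilizer Gal(PadicAlgCl p/ℚ_[p]) ζ := by
        rw [Subgroup.zpowers_le]
        exact h2
      exact hz hf
    rw [IntermediateField.mem_fixingSubgroup_iff]
    intro x hx
    exact (mem_fixedField_iff _ _).1 (hle hx) g (Subgroup.mem_zpowers g)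
  · intro hg
    rw [IntermediateField.mem_fixingSubgroup_iff] at hg
    refine Units.ext (PadicInt.ext_of_toZModPow.1 fun n => ?_)
    rw [cyclotomicCharacter.toZModPow, Units.val_one, map_one]
    symm
    apply modularCyclotomicCharacter.unique
    intro t ht
    have ht' : (t : PadicAlgCl p) ^ p ^ n = 1 := by
      rw [mem_rootsOfUnity] at ht
      rw [← Units.val_pow_eq_pow_val, ht, Units.val_one]
    have h2 : g (t : PadicAlgCl p) = t := hg _ (subset_adjoin _ _ ⟨n, ht'⟩)
    have h3 : (t : PadicAlgCl p) ^ (1 : ZMod (p ^ n)).val = t := by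
      rcases Nat.eq_zero_or_pos n with rfl | hn0
      · rw [pow_zero, pow_one] at ht'
        rw [ht', one_pow]
      · have : Fact (1 < p ^ n) :=
          ⟨Nat.one_lt_pow hn0.ne' (Fact.out : p.Prime).one_lt⟩
        rw [ZMod.val_one, pow_one]
    exact h2.trans h3.symm

end PadicGalois

/-! ### Transfer of trace-one elements to `HK` -/

namespace PadicGalois

open Polynomial IntermediateField Filter

variable {p : ℕ} [Fact p.Prime]

theorem norm_sum_galois_le {ι : Type*} [Fintype ι] (s : ι → Gal(PadicAlgCl p/ℚ_[p]))
    (x : PadicAlgCl p) :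
    ‖∑ i, s i x‖ ≤ ‖x‖ :=
  IsUltrametricDist.norm_sum_le_of_forall_le_of_nonneg (norm_nonneg _) fun _ _ =>
    (norm_galois _ x).le

theorem galois_sum_eq_of_isTransversal {ι : Type*} [Fintype ι]
    {G U : Subgroup Gal(PadicAlgCl p/ℚ_[p])}
    {s : ι → Gal(PadicAlgCl p/ℚ_[p])} (hs : IsTransversal G U s) {x : PadicAlgCl p}
      (hx : ∀ u ∈ U, u x = x)
    {g : Gal(PadicAlgCl p/ℚ_[p])} (hg : g ∈ G) : g (∑ i, s i x) = ∑ i, s i x := by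
  rw [map_sum]
  exact ((hs.mul_left hg).sum_eq hs (fun γ => γ x) fun γ u hu => by
    change γ (u x) = γ x
    rw [hx u hu])

/-- Transfer of an element of trace one from the group `G` to the group `H`. -/
theorem exists_trace_eq_one_transfer {G H U U₀ : Subgroup Gal(PadicAlgCl p/ℚ_[p])} (h1 : U₀ ≤ U)
    (h2 : U ≤ H) (h3 : U₀ ≤ G) {ι : Type*} [Fintype ι] {s : ι → Gal(PadicAlgCl p/ℚ_[p])}
    (hs : IsTransversal G U₀ s) {α : PadicAlgCl p} (hα : ∀ u ∈ U₀, u α = α) (hsum : ∑ i, s i α = 1)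
    (hidx : (H ⊓ G).relIndex H ≠ 0) :
    ∃ (n : ℕ) (t : Fin n → Gal(PadicAlgCl p/ℚ_[p])) (β : PadicAlgCl p), IsTransversal H U t ∧
      (∀ u ∈ U, u β = β) ∧ ∑ i, t i β = 1 ∧ ‖β‖ ≤ ‖α‖ / ‖((H ⊓ G).relIndex H : PadicAlgCl p)‖ := by
  set H₀ := H ⊓ G with hH₀
  have hU₀H₀ : U₀ ≤ H₀ := le_inf (h1.trans h2) h3
  have hmul := Subgroup.relIndex_mul_relIndex U₀ H₀ G hU₀H₀ inf_le_right
  have hne := hs.relIndex_ne_zero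
  obtain ⟨a, tA, -, htA⟩ := exists_isTransversal (G := H₀) (U := U₀) fun h => hne (by
    rw [← hmul, h, zero_mul])
  obtain ⟨b, tB, -, htB⟩ := exists_isTransversal (G := G) (U := H₀) fun h => hne (by
    rw [← hmul, h, mul_zero])
  obtain ⟨c, tC, hc, htC⟩ := exists_isTransversal hidx
  have hCA := htC.mul htA hU₀H₀ inf_le_left
  have hmul' := Subgroup.relIndex_mul_relIndex U₀ U H h1 h2
  obtain ⟨d, tD, -, htD⟩ := exists_isTransversal (G := U) (U := U₀) fun h =>
    hCA.relIndex_ne_zero (by rw [← hmul', h, zero_mul])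
  obtain ⟨e, tE, -, htE⟩ := exists_isTransversal (G := H) (U := U) fun h =>
    hCA.relIndex_ne_zero (by rw [← hmul', h, mul_zero])
  have hinv : ∀ {x : PadicAlgCl p}, (∀ u ∈ U₀, u x = x) → ∀ g : Gal(PadicAlgCl p/ℚ_[p]), ∀ u ∈ U₀,
      (g * u) x = g x := fun hx g u hu => by
    change g (u _) = g _
    rw [hx u hu]
  set S := ∑ i, tA i α with hS
  -- The translates of S by representatives of G/H₀ sum to 1, and Galois acts by isometries.
  have hS1 : 1 ≤ ‖S‖ := by
    have h4 := (htB.mul htA hU₀H₀ inf_le_right).sum_eq hs (fun γ => γ α) (hinv hα)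
    rw [hsum, Fintype.sum_prod_type] at h4
    have h5 : ∑ i, tB i S = 1 := by
      rw [← h4]
      exact Finset.sum_congr rfl fun i _ => by rw [hS, map_sum]; rfl
    rw [← norm_one (α := PadicAlgCl p), ← h5]
    exact norm_sum_galois_le tB S
  have hS0 : S ≠ 0 := norm_pos_iff.1 (one_pos.trans_le hS1)
  have hSfix : ∀ g ∈ H₀, g S = S := fun g hg => galois_sum_eq_of_isTransversal htA hα hg
  set m : PadicAlgCl p := ((H₀.relIndex H : ℕ) : PadicAlgCl p) with hm
  have hm0 : m ≠ 0 := Nat.cast_ne_zero.2 hidx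
  -- Both S and m are fixed by H₀, so α₂ has H₀/U₀-trace 1/m; summing over the m cosets of H₀ in H
  -- gives 1. The trace of α₂ from U₀ to U is then the required β.
  set α₂ : PadicAlgCl p := α / (S * m) with hα₂
  have hα₂fix : ∀ u ∈ U₀, u α₂ = α₂ := fun u hu => by
    rw [hα₂, map_div₀, map_mul, hα u hu, hSfix u (hU₀H₀ hu), hm, map_natCast]
  have hsumA : ∑ i, tA i α₂ = m⁻¹ := by
    have : ∀ i, tA i α₂ = tA i α / (S * m) := fun i => by
      rw [hα₂, map_div₀, map_mul, hSfix _ (htA.mem i), hm, map_natCast]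
    simp_rw [this]
    rw [← Finset.sum_div, ← hS, div_mul_eq_div_div, div_self hS0, one_div]
  have hsumCA : ∑ x : Fin c × Fin a, (tC x.1 * tA x.2) α₂ = 1 := by
    rw [Fintype.sum_prod_type]
    have : ∀ i, ∑ j, (tC i * tA j) α₂ = m⁻¹ := fun i => by
      have h5 : ∑ j, (tC i * tA j) α₂ = tC i (∑ j, tA j α₂) := by rw [map_sum]; rfl
      rw [h5, hsumA, map_inv₀, hm, map_natCast]
    simp only [this]
    rw [Finset.sum_const, Finset.card_univ, Fintype.card_fin, nsmul_eq_mul, hc, ← hm,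
      mul_inv_cancel₀ hm0]
  refine ⟨e, tE, ∑ i, tD i α₂, htE, fun u hu => galois_sum_eq_of_isTransversal htD hα₂fix hu, ?_,
    ?_⟩
  · rw [← hsumCA, ← (htE.mul htD h1 h2).sum_eq hCA (fun γ => γ α₂) (hinv hα₂fix),
      Fintype.sum_prod_type]
    exact Finset.sum_congr rfl fun i _ => by rw [map_sum]; rfl
  · refine (norm_sum_galois_le tD α₂).trans ?_
    rw [hα₂, norm_div, norm_mul]
    have : 0 < ‖m‖ := norm_pos_iff.2 hm0
    gcongr
    exact le_mul_of_one_le_left (norm_nonneg _) hS1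

theorem inv_two_le_norm_natCast {m : ℕ} (h0 : m ≠ 0) (h : m ≤ if p = 2 then 2 else p - 1) :
    (2 : ℝ)⁻¹ ≤ ‖(m : PadicAlgCl p)‖ := by
  by_cases hd : p ∣ m
  · have hle := Nat.le_of_dvd (Nat.pos_of_ne_zero h0) hd
    have hp1 := (Fact.out : p.Prime).one_lt
    split_ifs at h with hp
    · have hm : m = p := by omega
      rw [hm, norm_natCast_p, hp]
      norm_num
    · omega
  · rw [norm_natCast_eq_one_of_not_dvd hd]
    norm_num

variable (K : IntermediateField ℚ_[p] (PadicAlgCl p))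

/-- The inclusion of `H_K` into the absolute Galois group of `ℚ_p`. -/
def hkHom : HK p K →* Gal(PadicAlgCl p/ℚ_[p]) :=
  (AlgEquiv.restrictScalarsHom ℚ_[p]).comp (HK p K).subtype

theorem hkHom_injective : Function.Injective (hkHom K) :=
  (AlgEquiv.restrictScalarsHom_injective ℚ_[p]).comp (HK p K).subtype_injective

/-- The cyclotomic character maps `HK` into the roots of unity of order dividing the exponent in
Z_p, with kernel the intersection with the Galois group of `cycField`. -/
theorem relIndex_range_hkHom_inf :
    ((hkHom K).range ⊓ (cycField p).fixingSubgroup).relIndex (hkHom K).range ≠ 0 ∧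
      ((hkHom K).range ⊓ (cycField p).fixingSubgroup).relIndex (hkHom K).range ≤
        if p = 2 then 2 else p - 1 := by
  set M := if p = 2 then 2 else p - 1 with hM
  have hp2 := (Fact.out : p.Prime).two_le
  have hM0 : NeZero M := ⟨by rw [hM]; split_ifs <;> omega⟩
  let f : HK p K →* rootsOfUnity M ℤ_[p] :=
    { toFun h := ⟨cyclotomicChar p K h, by
        rw [mem_rootsOfUnity]
        exact MonoidHom.mem_ker.1 h.2⟩
      map_one' := by ext; simp
      map_mul' a b := by ext; simp }
  have hker : f.ker = ((hkHom K).range ⊓ (cycField p).fixingSubgroup).comap (hkHom K) := by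
    ext h
    rw [MonoidHom.mem_ker, Subgroup.mem_comap, Subgroup.mem_inf,
      ← cyclotomicCharacter_eq_one_iff, Subtype.ext_iff]
    exact ⟨fun hh => ⟨⟨h, rfl⟩, hh⟩, fun hh => hh.2⟩
  have hidx : ((hkHom K).range ⊓ (cycField p).fixingSubgroup).relIndex (hkHom K).range =
      Nat.card f.range := by
    rw [← Subgroup.index_ker, hker, Subgroup.index_comap]
  rw [hidx]
  refine ⟨Nat.card_pos.ne', ?_⟩
  exact (Nat.card_le_card_of_injective _ f.range.subtype_injective).trans
    (card_rootsOfUnity ℤ_[p] M)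

/-- **Tate's theorem**: for every open subgroup `U` of `H_K` there is a `U`-invariant element of
trace one and of norm at most `4`. -/
theorem exists_isTransversal_sum_eq_one [FiniteDimensional ℚ_[p] K] (U : Subgroup (HK p K))
    (hU : IsOpen (U : Set (HK p K))) :
    ∃ (n : ℕ) (s : Fin n → HK p K) (α : PadicAlgCl p), IsTransversal ⊤ U s ∧
      (∀ u ∈ U, (u : Gal((PadicAlgCl p)/K)) α = α) ∧
        ∑ i, (s i : Gal((PadicAlgCl p)/K)) α = 1 ∧ ‖α‖ ≤ 4 := by
  obtain ⟨V, hV, hVU⟩ := mem_nhds_subtype _ _ _ |>.1 (hU.mem_nhds (one_mem U))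
  obtain ⟨N, hN, hNV⟩ := (krullTopology_mem_nhds_one_iff _ _ _).1 hV
  have hNfin : FiniteDimensional ℚ_[p] (N.restrictScalars ℚ_[p]) := by
    have : FiniteDimensional ℚ_[p] N := FiniteDimensional.trans ℚ_[p] K N
    exact this
  obtain ⟨⟨y, hyN⟩, hy⟩ := Field.exists_primitive_element ℚ_[p] (N.restrictScalars ℚ_[p])
  have hNy : ∀ x ∈ N, x ∈ ℚ_[p]⟮y⟯ := fun x hx => by
    have h1 : (⟨x, hx⟩ : N.restrictScalars ℚ_[p]) ∈
        ℚ_[p]⟮(⟨y, hyN⟩ : N.restrictScalars ℚ_[p])⟯ := hy ▸ mem_top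
    have h2 : x ∈ (ℚ_[p]⟮(⟨y, hyN⟩ : N.restrictScalars ℚ_[p])⟯).map
        (N.restrictScalars ℚ_[p]).val := ⟨_, h1, rfl⟩
    rwa [adjoin_map, Set.image_singleton] at h2
  obtain ⟨E, hE, htr, hyE⟩ := exists_almostTrace_cycField y
  -- Taking ε = 1 gives |α| ≤ 2, and dividing by the index, of norm at least 1/2, gives the bound 4.
  obtain ⟨α, hα, hα2⟩ := htr 1 one_pos
  obtain ⟨ι, _, s, hs, hsum⟩ := exists_isTransversal_trace E
  set U₀ := (E.restrictScalars ℚ_[p]).fixingSubgroup with hU₀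
  have h3 : U₀ ≤ (cycField p).fixingSubgroup := by
    intro g hg
    rw [IntermediateField.mem_fixingSubgroup_iff] at hg ⊢
    exact fun x hx => hg x (IntermediateField.algebraMap_mem E ⟨x, hx⟩)
  have h1 : U₀ ≤ U.map (hkHom K) := by
    intro g hg
    have hgc := h3 hg
    rw [IntermediateField.mem_fixingSubgroup_iff] at hg
    have hgN : ∀ x ∈ N, g x = x := fun x hx => by
      have hle : ℚ_[p]⟮y⟯ ≤ E.restrictScalars ℚ_[p] := adjoin_simple_le_iff.2 hyE
      exact hg x (hle (hNy x hx))
    let g' : Gal((PadicAlgCl p)/K) :=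
      { (g : PadicAlgCl p ≃+* PadicAlgCl p) with
        commutes' := fun x => hgN x (IntermediateField.algebraMap_mem N x) }
    -- An automorphism fixing E fixes all p-power roots of unity, so its cyclotomic character is
    -- trivial.
    have hg' : g' ∈ HK p K := by
      rw [HK, MonoidHom.mem_ker, MonoidHom.pow_apply]
      have : cyclotomicChar p K g' = 1 := (cyclotomicCharacter_eq_one_iff g).2 hgc
      rw [this, one_pow]
    refine ⟨⟨g', hg'⟩, hVU (hNV ?_), rfl⟩
    rw [SetLike.mem_coe, IntermediateField.mem_fixingSubgroup_iff]
    exact hgN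
  obtain ⟨hidx0, hidx⟩ := relIndex_range_hkHom_inf K
  obtain ⟨n, t, β, ht, hβ, hβsum, hβn⟩ := exists_trace_eq_one_transfer (H := (hkHom K).range)
    (U := U.map (hkHom K)) h1 (by
      rintro _ ⟨u, -, rfl⟩
      exact ⟨u, rfl⟩) h3 hs (α := α) (fun u hu => by
      rw [hU₀, IntermediateField.mem_fixingSubgroup_iff] at hu
      exact hu α α.2) (by rw [hsum, hα, map_one]) hidx0
  choose r hr using ht.mem
  refine ⟨n, r, β, ⟨fun i => Subgroup.mem_top _, fun g _ => ?_⟩, fun u hu => ?_, ?_, ?_⟩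
  · obtain ⟨i, hi, hui⟩ := ht.existsUnique (hkHom K g) ⟨g, rfl⟩
    have hmem : ∀ i, (r i)⁻¹ * g ∈ U ↔ (t i)⁻¹ * hkHom K g ∈ U.map (hkHom K) := fun i => by
      rw [← hr, ← map_inv, ← map_mul, Subgroup.mem_map_iff_mem (hkHom_injective K)]
    exact ⟨i, (hmem i).2 hi, fun j hj => hui j ((hmem j).1 hj)⟩
  · exact hβ (hkHom K u) ⟨u, hu, rfl⟩
  · rw [← hβsum]
    exact Finset.sum_congr rfl fun i _ => by rw [← hr]; rfl
  · refine hβn.trans ?_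
    have h4 := inv_two_le_norm_natCast (p := p) hidx0 hidx
    rw [div_le_iff₀ (by linarith)]
    linarith

end PadicGalois

/-! ### Descent: averaging continuous cocycles -/

section

open Filter Topology

/-- Uniform continuity on a compact group, combined with the fact that open subgroups form a
neighbourhood basis of the identity in a profinite group. -/
theorem exists_openSubgroup_norm_sub_le {G N : Type*} [Group G] [TopologicalSpace G]
    [IsTopologicalGroup G] [CompactSpace G] [TotallyDisconnectedSpace G]
    [NormedAddCommGroup N] (f : C(G, N)) {ε : ℝ} (hε : 0 < ε) :
    ∃ U : Subgroup G, IsOpen (U : Set G) ∧ ∀ x, ∀ u ∈ U, ‖f (x * u) - f x‖ ≤ ε := by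
  have h := (isCompact_univ (X := G)).eventually_forall_of_forall_eventually (x₀ := (1 : G))
    (P := fun u x => ‖f (x * u) - f x‖ < ε) (fun x _ => by
      have hc : Continuous fun z : G × G => ‖f (z.2 * z.1) - f z.2‖ := by fun_prop
      exact hc.continuousAt.eventually (gt_mem_nhds (by simpa using hε)))
  obtain ⟨W, hWsub, hW, h1W⟩ := mem_nhds_iff.1 h
  obtain ⟨U, hU⟩ := ProfiniteGrp.exist_openNormalSubgroup_sub_open_nhds_of_one hW h1W
  exact ⟨U.toSubgroup, U.isOpen', fun x u hu => (hWsub (hU hu) x (Set.mem_univ x)).le⟩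

section Descent

variable {𝕜 : Type*} [NormedField 𝕜] {G : Type*} [Group G] [TopologicalSpace G]
  [IsTopologicalGroup G]

/-- The semilinear action `σ` of `G` on `𝕜` has, for every open subgroup, elements of trace one and
of norm at most `B`: they are recorded by their orbit maps `a`. -/
def BoundedTraces (σ : G → 𝕜 → 𝕜) (B : ℝ) : Prop :=
  ∀ U : Subgroup G, IsOpen (U : Set G) →
    ∃ (n : ℕ) (s : Fin n → G) (a : G → 𝕜), IsTransversal ⊤ U s ∧
      (∀ g, ∀ u ∈ U, a (g * u) = a g) ∧ (∀ g, ∑ i, a (g * s i) = 1) ∧ (∀ g, ‖a g‖ ≤ B) ∧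
      ∀ g h, σ g (a h) = a (g * h)

variable [CompactSpace G] [TotallyDisconnectedSpace G]
  {V : Type*} [NormedAddCommGroup V] [NormedSpace 𝕜 V] [IsUltrametricDist V]

theorem continuous_of_right_invariant {X : Type*} [TopologicalSpace X] {U : Subgroup G}
    (hU : IsOpen (U : Set G)) {a : G → X} (ha : ∀ g, ∀ u ∈ U, a (g * u) = a g) :
    Continuous a := by
  refine IsLocallyConstant.continuous ((IsLocallyConstant.iff_exists_open a).2 fun x => ?_)
  refine ⟨(fun y => x⁻¹ * y) ⁻¹' U, hU.preimage (continuous_const_mul _), by simp, fun y hy => ?_⟩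
  rw [← ha x _ hy, mul_inv_cancel_left]

/-- A continuous two-variable cochain `f` is an equivariant cocycle with respect to the
differential built from `δ`. -/
structure IsDescentCocycle (ρ : G → V → V) (δ : V → C(G, V)) (f : C(G, C(G, V))) : Prop where
  equivariant : ∀ g x y, f (g * x) (g * y) = ρ g (f x y)
  cocycle : ∀ x z y, f z y = f x y - δ (f x z) y

variable {σ : G → 𝕜 → 𝕜} {B : ℝ} {ρ : G → V →+ V} {δ : V →L[𝕜] C(G, V)}

/-- Up to an error which is smaller by a factor `2`, a cocycle is a coboundary. -/
theorem IsDescentCocycle.exists_approx (hB : 0 < B) (hσ : BoundedTraces σ B)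
    (hρ : ∀ g c v, ρ g (c • v) = σ g c • ρ g v)
    (hδρ : ∀ g v y, δ (ρ g v) (g * y) = ρ g (δ v y))
    (hδδ : ∀ v z y, δ (δ v z) y = δ v y) {f : C(G, C(G, V))}
    (hf : IsDescentCocycle (fun g => ρ g) δ f) {r : ℝ} (hr : 0 < r) (hfr : ∀ x y, ‖f x y‖ ≤ r) :
    ∃ (e : C(G, V)) (f' : C(G, C(G, V))), (∀ g y, e (g * y) = ρ g (e y)) ∧ (∀ y, ‖e y‖ ≤ B * r) ∧
      IsDescentCocycle (fun g => ρ g) δ f' ∧ (∀ x y, ‖f' x y‖ ≤ r / 2) ∧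
      ∀ z y, f z y = f' z y + (e y - δ (e z) y) := by
  obtain ⟨U, hU, hfU⟩ := exists_openSubgroup_norm_sub_le f (ε := r / (2 * B)) (by positivity)
  obtain ⟨n, s, a, hs, haU, hasum, hanorm, haσ⟩ := hσ U hU
  have hac : Continuous a := continuous_of_right_invariant hU haU
  -- This is the contracting homotopy f(x, y) ↦ f(1, y), made equivariant by averaging x over y s_i
  -- with weights a(y s_i) of total one.
  let e : C(G, V) :=
    { toFun y := ∑ i, a (y * s i) • f (y * s i) y
      continuous_toFun := by fun_prop }
  have he : ∀ y, e y = ∑ i, a (y * s i) • f (y * s i) y := fun y => rfl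
  have hee : ∀ g y, e (g * y) = ρ g (e y) := fun g y => by
    rw [he, he, map_sum]
    refine Finset.sum_congr rfl fun i _ => ?_
    rw [hρ, haσ, ← hf.equivariant g, mul_assoc]
  have hδe : ∀ z y, δ (e z) y = ∑ i, a (z * s i) • f (z * s i) y - f z y := fun z y => by
    have h1 : ∀ i, δ (f (z * s i) z) y = f (z * s i) y - f z y := fun i => by
      rw [hf.cocycle (z * s i) z y, sub_sub_cancel]
    rw [he, map_sum, ContinuousMap.sum_apply]
    simp_rw [map_smul, ContinuousMap.smul_apply, h1, smul_sub]
    rw [Finset.sum_sub_distrib, ← Finset.sum_smul, hasum, one_smul]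
  let f' : C(G, C(G, V)) := f -
    (ContinuousMap.const G e - (⟨δ, δ.continuous⟩ : C(V, C(G, V))).comp e)
  have hf' : ∀ z y, f' z y = f z y - (e y - δ (e z) y) := fun z y => rfl
  refine ⟨e, f', hee, fun y => ?_, ⟨fun g x y => ?_, fun x z y => ?_⟩, fun z y => ?_, fun z y => ?_⟩
  · rw [he]
    refine IsUltrametricDist.norm_sum_le_of_forall_le_of_nonneg (by positivity) fun i _ => ?_
    rw [norm_smul]
    gcongr
    exacts [hanorm _, hfr _ _]
  · simp only [hf']
    rw [hf.equivariant, hee, hee, hδρ, map_sub, map_sub]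
  · simp only [hf', map_sub, ContinuousMap.sub_apply]
    rw [hf.cocycle x z y, hδδ]
    abel
  · have h1 : f' z y = ∑ i, a (z * s i) • f (z * s i) y - ∑ i, a (y * s i) • f (y * s i) y := by
      rw [hf', hδe, he]
      abel
    -- The new error compares weighted sums over the two transversals z s_i and y s_i. After
    -- matching cosets of U the weights agree, and the values of f differ by at most r/(2B).
    obtain ⟨q, hq⟩ := (hs.mul_left (Subgroup.mem_top z)).exists_equiv
      (hs.mul_left (Subgroup.mem_top y))
    rw [h1, ← Equiv.sum_comp q fun i => a (y * s i) • f (y * s i) y, ← Finset.sum_sub_distrib]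
    refine IsUltrametricDist.norm_sum_le_of_forall_le_of_nonneg (by positivity) fun i _ => ?_
    have h2 : z * s i = y * s (q i) * ((y * s (q i))⁻¹ * (z * s i)) := by group
    rw [h2, haU _ _ (hq i), ← smul_sub, norm_smul]
    have h3 : ‖f (y * s (q i) * ((y * s (q i))⁻¹ * (z * s i))) y - f (y * s (q i)) y‖ ≤
        r / (2 * B) := by
      refine le_trans ?_ (hfU (y * s (q i)) _ (hq i))
      rw [← ContinuousMap.sub_apply]
      exact ContinuousMap.norm_coe_le_norm _ _
    calc _ ≤ B * (r / (2 * B)) := by gcongr; exact hanorm _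
      _ = r / 2 := by field_simp
  · rw [hf', sub_add_cancel]

/-- A cocycle with values in a Banach space with semilinear action is a coboundary. -/
theorem IsDescentCocycle.exists_eq [CompleteSpace V] (hB : 0 < B) (hσ : BoundedTraces σ B)
    (hρc : ∀ g, Continuous (ρ g))
    (hρ : ∀ g c v, ρ g (c • v) = σ g c • ρ g v)
    (hδρ : ∀ g v y, δ (ρ g v) (g * y) = ρ g (δ v y))
    (hδδ : ∀ v z y, δ (δ v z) y = δ v y) {f : C(G, C(G, V))}
    (hf : IsDescentCocycle (fun g => ρ g) δ f) :
    ∃ e : C(G, V), (∀ g y, e (g * y) = ρ g (e y)) ∧ ∀ z y, f z y = e y - δ (e z) y := by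
  set R := ‖f‖ + 1 with hR
  have hR0 : 0 < R := by positivity
  have hfR : ∀ x y, ‖f x y‖ ≤ R := fun x y =>
    ((ContinuousMap.norm_coe_le_norm _ _).trans (ContinuousMap.norm_coe_le_norm _ _)).trans
      (by linarith)
  have step : ∀ (k : ℕ) (F : {F : C(G, C(G, V)) // IsDescentCocycle (fun g => ρ g) δ F ∧
      ∀ x y, ‖F x y‖ ≤ R / 2 ^ k}), ∃ (e : C(G, V)) (F' : C(G, C(G, V))),
      (∀ g y, e (g * y) = ρ g (e y)) ∧ (∀ y, ‖e y‖ ≤ B * (R / 2 ^ k)) ∧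
      (IsDescentCocycle (fun g => ρ g) δ F' ∧ ∀ x y, ‖F' x y‖ ≤ R / 2 ^ (k + 1)) ∧
      ∀ z y, F.1 z y = F' z y + (e y - δ (e z) y) := fun k F => by
    obtain ⟨e, F', h1, h2, h3, h4, h5⟩ := F.2.1.exists_approx hB hσ hρ hδρ hδδ
      (r := R / 2 ^ k) (by positivity) F.2.2
    exact ⟨e, F', h1, h2, ⟨h3, fun x y => (h4 x y).trans_eq (by rw [pow_succ]; field_simp)⟩, h5⟩
  choose E F' hE1 hE2 hF' hEF using step
  let S : (k : ℕ) → {F : C(G, C(G, V)) // IsDescentCocycle (fun g => ρ g) δ F ∧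
      ∀ x y, ‖F x y‖ ≤ R / 2 ^ k} := fun k =>
    -- The remaining errors, of size at most R/2^k after k corrections.
    Nat.rec ⟨f, hf, by simpa using hfR⟩ (fun k F => ⟨F' k F, hF' k F⟩) k
  set e : ℕ → C(G, V) := fun k => E k (S k) with he
  have hsum : ∀ k z y, f z y = (S k).1 z y +
      ((∑ i ∈ Finset.range k, e i) y - δ ((∑ i ∈ Finset.range k, e i) z) y) := by
    intro k
    induction k with
    | zero => intro z y; simp [S]
    | succ k ih =>
      intro z y
      rw [ih, hEF k (S k) z y, Finset.sum_range_succ]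
      change (S (k + 1)).1 z y + _ + _ = _
      simp only [ContinuousMap.add_apply, map_add, he]
      abel
  have hsummable : Summable e := by
    refine Summable.of_norm_bounded (g := fun k => B * R * (1 / 2) ^ k)
      (summable_geometric_two.mul_left _) fun k => ?_
    rw [ContinuousMap.norm_le _ (by positivity)]
    intro y
    refine (hE2 k (S k) y).trans_eq ?_
    rw [one_div, inv_pow]
    ring
  have hlim := hsummable.hasSum.tendsto_sum_nat
  set e₀ := ∑' k, e k
  have hev : ∀ y, Tendsto (fun k => (∑ i ∈ Finset.range k, e i) y) atTop (𝓝 (e₀ y)) := fun y =>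
    ((continuous_eval_const (F := C(G, V)) y).tendsto e₀).comp hlim
  refine ⟨e₀, fun g y => ?_, fun z y => ?_⟩
  · refine tendsto_nhds_unique (hev (g * y)) ?_
    have h1 := ((hρc g).tendsto _).comp (hev y)
    refine h1.congr fun k => ?_
    simp only [Function.comp_apply, ContinuousMap.sum_apply, map_sum]
    exact Finset.sum_congr rfl fun i _ => (hE1 i (S i) g y).symm
  · have h0 : Tendsto (fun k => (S k).1 z y) atTop (𝓝 0) := by
      refine squeeze_zero_norm (fun k => (S k).2.2 z y) ?_
      have := (tendsto_pow_atTop_nhds_zero_of_lt_one (r := (1 / 2 : ℝ)) (by norm_num)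
        (by norm_num)).const_mul R
      rw [mul_zero] at this
      refine this.congr fun k => ?_
      rw [one_div, inv_pow]
      rfl
    have h1 : Tendsto (fun k => δ ((∑ i ∈ Finset.range k, e i) z) y) atTop (𝓝 (δ (e₀ z) y)) :=
      ((continuous_eval_const (F := C(G, V)) y).tendsto _).comp
        ((δ.continuous.tendsto _).comp (hev z))
    have h2 := h0.add ((hev y).sub h1)
    rw [zero_add] at h2
    exact tendsto_nhds_unique (tendsto_const_nhds.congr fun k => hsum k z y) h2

end Descent

end

/-! ### From cocycles to continuous cohomology -/

section

open CategoryTheory ContRepresentation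

/-- Exactness is detected on underlying modules, so preimages of cocycles need not be chosen
continuously. -/
theorem TopModuleCat.subsingleton_homology {R : Type*} [Ring R] [TopologicalSpace R]
    (S : ShortComplex (TopModuleCat R))
    (h : ∀ x, S.g.hom x = 0 → ∃ y, S.f.hom y = x) : Subsingleton S.homology := by
  have h1 : (S.map (forget₂ (TopModuleCat R) (ModuleCat R))).Exact :=
    (ShortComplex.moduleCat_exact_iff _).2 h
  have h2 : S.Exact := (S.exact_map_iff_of_faithful (forget₂ (TopModuleCat R) (ModuleCat R))).1 h1
  have h3 := (S.exact_iff_isZero_homology.1 h2).eq_of_src (𝟙 _) 0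
  refine ⟨fun x y => ?_⟩
  exact (ConcreteCategory.congr_hom h3 x).trans (ConcreteCategory.congr_hom h3 y).symm

namespace TopRep

variable {k : Type*} [Ring k] [TopologicalSpace k] {𝕜 : Type*} [NormedField 𝕜] {G : Type*}
    [Group G] [TopologicalSpace G]
  [IsTopologicalGroup G]

/-- The step from `δ` to the next differential in the resolution of a topological
representation. -/
def nextD {Y : TopRep k G} (δ : Y ⟶ Y.coind₁) : Y.coind₁ ⟶ Y.coind₁.coind₁ :=
  ofHom Y.coind₁.ρ.coind₁ι - (coind₁Functor k G).map δ

theorem nextD_apply {Y : TopRep k G} (δ : Y ⟶ Y.coind₁) (e : C(G, Y)) (z y : G) :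
    ((nextD δ).hom e : C(G, C(G, Y))) z y = e y - (δ.hom (e z) : C(G, Y)) y :=
  rfl

/-- `Y` is the topological representation underlying a Banach space over `𝕜` with a
`σ`-semilinear action, and `δ` is linear over `𝕜`. -/
inductive IsSemilinear (σ : G → 𝕜 → 𝕜) : (Y : TopRep k G) → (Y ⟶ Y.coind₁) → Prop
  | of {V : Type _} [NormedAddCommGroup V] [NormedSpace 𝕜 V] [IsUltrametricDist V]
      [CompleteSpace V] [Module k V] [ContinuousSMul k V] (ρ : ContRepresentation k G V)
      (hρ : ∀ g c v, ρ g (c • v) = σ g c • ρ g v)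
      (δ : TopRep.of ρ ⟶ (TopRep.of ρ).coind₁)
      (hδ : ∀ (c : 𝕜) (v : V) (y : G), (δ.hom (c • v) : C(G, V)) y = c • (δ.hom v : C(G, V)) y) :
      IsSemilinear σ (TopRep.of ρ) δ

variable {σ : G → 𝕜 → 𝕜}

/-- As G is compact, the sup norm makes C(G, V) again an ultrametric Banach space, with scalars
acting pointwise. This propagates the hypotheses through the resolution, so one descent argument
serves all degrees. -/
theorem IsSemilinear.nextD [CompactSpace G] {Y : TopRep k G} {δ : Y ⟶ Y.coind₁}
    (h : IsSemilinear σ Y δ) :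
    IsSemilinear σ Y.coind₁ (nextD δ) := by
  cases h with
  | of ρ hρ δ hδ =>
    refine .of (V := C(G, _)) ρ.coind₁ (fun g c f => ?_) (TopRep.nextD δ) fun c e z => ?_
    · ext x
      exact hρ g c _
    · ext y
      have h1 := nextD_apply δ (c • e) z y
      have h2 := nextD_apply δ e z y
      refine h1.trans ?_
      refine Eq.trans ?_ (congrArg (c • ·) h2).symm
      refine Eq.trans ?_ (smul_sub c (e y) _).symm
      exact congrArg (c • e y - ·) (hδ c (e z) y)

theorem IsSemilinear.resolution [CompactSpace G] {X : TopRep k G} (h : IsSemilinear σ X (d X 0))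
    (n : ℕ) :
    IsSemilinear σ (resolutionX X n) (d X n) := by
  induction n with
  | zero => exact h
  | succ n ih => exact ih.nextD

theorem IsSemilinear.exists_eq [CompactSpace G] [TotallyDisconnectedSpace G] {B : ℝ} (hB : 0 < B)
    (hσ : BoundedTraces σ B) {Y : TopRep k G} {δ : Y ⟶ Y.coind₁} (h : IsSemilinear σ Y δ)
    (hδδ : δ ≫ TopRep.nextD δ = 0) (f : Y.coind₁.coind₁) (hf : f ∈ Y.coind₁.coind₁.ρ.invariants)
    (hdf : (TopRep.nextD (TopRep.nextD δ)).hom f = 0) :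
    ∃ e : Y.coind₁, e ∈ Y.coind₁.ρ.invariants ∧ (TopRep.nextD δ).hom e = f := by
  cases h with
  | of ρ hρ δ hδ =>
    rename_i V _ _ _ _ _ _
    let δ' : V →L[𝕜] C(G, V) :=
      { toFun := fun v => δ.hom v
        map_add' := fun v w => map_add δ.hom v w
        map_smul' := fun c v => by ext y; exact hδ c v y
        cont := δ.hom.continuous }
    have hδρ : ∀ g v y, δ' (ρ g v) (g * y) = ρ g (δ' v y) := fun g v y => by
      have h1 : δ' (ρ g v) = ρ.coind₁ g (δ' v) := hom_comm_apply δ g v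
      rw [h1, coind₁_apply_apply, inv_mul_cancel_left]
    have hδδ' : ∀ v z y, δ' (δ' v z) y = δ' v y := fun v z y => by
      have h1 : (TopRep.nextD δ).hom (δ.hom v) = 0 := ConcreteCategory.congr_hom hδδ v
      have h2 := nextD_apply δ (δ' v) z y
      have h3 : (0 : V) = δ' v y - δ' (δ' v z) y :=
        Eq.trans (congrArg (fun F : C(G, C(G, V)) => F z y) h1).symm h2
      exact (sub_eq_zero.1 h3.symm).symm
    have hf' : IsDescentCocycle (fun g => ρ g) δ' f := by
      refine ⟨fun g x y => ?_, fun x z y => ?_⟩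
      · have h1 : ρ.coind₁.coind₁ g f = f := hf g
        have h2 := congrArg (fun F : C(G, C(G, V)) => F (g * x) (g * y)) h1
        refine h2.symm.trans ?_
        change ρ g ((f : C(G, C(G, V))) (g⁻¹ * (g * x)) (g⁻¹ * (g * y))) = _
        rw [inv_mul_cancel_left, inv_mul_cancel_left]
      -- Evaluated at x, z, y, the cocycle condition reads f(z, y) - (f(x, y) - δ(f(x, z))(y)) = 0.
      · have h1 := congrArg (fun F : C(G, C(G, C(G, V))) => F x z y) hdf
        exact sub_eq_zero.1 h1
    obtain ⟨e, he1, he2⟩ := hf'.exists_eq (ρ := fun g => ((ρ g : V →L[k] V) : V →+ V)) hB hσ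
      (fun g => (ρ g).continuous) hρ hδρ hδδ'
    refine ⟨e, fun g => ?_, ?_⟩
    · refine ContinuousMap.ext fun y => ?_
      change ρ g (e (g⁻¹ * y)) = e y
      refine (he1 g (g⁻¹ * y)).symm.trans ?_
      rw [mul_inv_cancel_left]
    · refine ContinuousMap.ext fun z => ContinuousMap.ext fun y => ?_
      exact (he2 z y).symm

/-- Vanishing of the continuous cohomology of a Banach space with semilinear action. -/
theorem IsSemilinear.subsingleton_continuousCohomology [CompactSpace G]
    [TotallyDisconnectedSpace G] {B : ℝ} (hB : 0 < B) (hσ : BoundedTraces σ B) {X : TopRep k G}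
    (h : IsSemilinear σ X (d X 0)) {n : ℕ} (hn : 0 < n) :
    Subsingleton (continuousCohomology n X) := by
  obtain ⟨m, rfl⟩ : ∃ m, n = m + 1 := ⟨n - 1, by omega⟩
  have key : ∀ x : (homogeneousCochains X).X (m + 1),
      ((homogeneousCochains X).d (m + 1) (m + 2)).hom x = 0 →
      ∃ y : (homogeneousCochains X).X m, ((homogeneousCochains X).d m (m + 1)).hom y = x := by
    intro x hx
    have h1 := congrArg Subtype.val hx
    rw [homogeneousCochains.d_apply] at h1
    obtain ⟨e, he, hde⟩ := (h.resolution m).exists_eq hB hσ (d_comp_d X m) x.1 x.2 h1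
    exact ⟨⟨e, he⟩, Subtype.ext ((homogeneousCochains.d_apply X m ⟨e, he⟩).trans hde)⟩
  have hS : Subsingleton ((homogeneousCochains X).sc' m (m + 1) (m + 2)).homology :=
    TopModuleCat.subsingleton_homology _ key
  have e := ShortComplex.homologyMapIso ((homogeneousCochains X).isoSc' m (m + 1) (m + 2)
    (by simp) (by simp))
  exact ((forget _).mapIso e).toEquiv.subsingleton

end TopRep

end

/-! ### Verification of the descent hypotheses for `HK` -/

namespace PadicGalois

open Filter

variable {p : ℕ} [Fact p.Prime]

theorem continuous_cyclotomicChar (K : IntermediateField ℚ_[p] (PadicAlgCl p)) :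
    Continuous (cyclotomicChar p K) :=
  cyclotomicCharacter.continuous p K (PadicAlgCl p)

theorem isClosed_HK (K : IntermediateField ℚ_[p] (PadicAlgCl p)) :
    IsClosed (HK p K : Set Gal((PadicAlgCl p)/K)) := by
  have h : Continuous fun g => cyclotomicChar p K g ^ (if p = 2 then 2 else p - 1) :=
    (continuous_cyclotomicChar K).pow _
  exact isClosed_singleton.preimage h (t := {1})

theorem compactSpace_HK (K : IntermediateField ℚ_[p] (PadicAlgCl p)) : CompactSpace (HK p K) := by
  have : IsGalois K (PadicAlgCl p) := ⟨⟩
  exact (isClosed_HK K).isClosedEmbedding_subtypeVal.compactSpace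

theorem actCp_coe {K : IntermediateField ℚ_[p] (PadicAlgCl p)} (g : Gal((PadicAlgCl p)/K))
    (x : PadicAlgCl p) :
    actCp g (x : ℂ_[p]) = ((g x : PadicAlgCl p) : ℂ_[p]) :=
  UniformSpace.Completion.mapRingHom_coe (isometry_gal g).continuous x

theorem boundedTraces_actCp (K : IntermediateField ℚ_[p] (PadicAlgCl p))
    [FiniteDimensional ℚ_[p] K] :
    BoundedTraces (fun h : HK p K => ⇑(actCp (h : Gal((PadicAlgCl p)/K)))) 4 := by
  intro U hU
  obtain ⟨n, s, α, hs, hα, hsum, hnorm⟩ := exists_isTransversal_sum_eq_one K U hU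
  refine ⟨n, s, fun g => (((g : Gal((PadicAlgCl p)/K)) α : PadicAlgCl p) : ℂ_[p]), hs,
    fun g u hu => ?_,
    fun g => ?_, fun g => ?_, fun g h => actCp_coe _ _⟩
  · simp only [Subgroup.coe_mul, AlgEquiv.mul_apply, hα u hu]
  · have h1 : ∑ i, ((g * s i : HK p K) : Gal((PadicAlgCl p)/K)) α = 1 := by
      simp only [Subgroup.coe_mul, AlgEquiv.mul_apply]
      rw [← map_sum, hsum, map_one]
    have h2 := congrArg (UniformSpace.Completion.coeRingHom (α := PadicAlgCl p)) h1
    rw [map_sum, map_one] at h2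
    exact h2
  · refine (UniformSpace.Completion.norm_coe _).trans_le ?_
    exact (((isometry_gal (g : Gal((PadicAlgCl p)/K))).norm_map_of_map_zero (map_zero _)
      α).trans_le hnorm)

end PadicGalois

end

theorem mainTheorem11 (p : ℕ) [Fact p.Prime]
    (K : IntermediateField ℚ_[p] (PadicAlgCl p)) [FiniteDimensional ℚ_[p] K]
    (M : Type*) [NormedAddCommGroup M] [IsUltrametricDist M] [NormedSpace ℂ_[p] M]
    [CompleteSpace M]
    [DistribMulAction (PadicGalois.HK p K) M] [ContinuousSMul (PadicGalois.HK p K) M]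
    (hsemilinear : ∀ (h : PadicGalois.HK p K) (c : ℂ_[p]) (m : M),
      h • (c • m) = PadicGalois.actCp (h : Gal((PadicAlgCl p)/K)) c • (h • m))
    (n : ℕ) (hn : 0 < n) :
    Subsingleton (continuousCohomology n (topRepOfAction (PadicGalois.HK p K) M)) := by
  have := PadicGalois.compactSpace_HK K
  have h : TopRep.IsSemilinear
      (fun h : PadicGalois.HK p K => ⇑(PadicGalois.actCp (h : Gal((PadicAlgCl p)/K))))
      (topRepOfAction (PadicGalois.HK p K) M) (TopRep.d _ 0) :=
    -- The first differential sends a vector to the constant function, so its linearity over the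
    -- field is definitional.
    .of (V := M) _ hsemilinear _ fun _ _ _ => rfl
  exact h.subsingleton_continuousCohomology four_pos (PadicGalois.boundedTraces_actCp K) hn
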